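/- **Theorem.** Let $K$ and $L$ be compact Hausdorff spaces and let $\mu$ be a finite positive regular Borel measure on $L$. For a compact Hausdorff space $X$ let $M(X)$ be the space of complex regular Borel measures on $X$, with the total variation measure $|\rho|$ as absolute value and the norm $\|\rho\|=|\rho|(X)$; let $C(K)$ and $L^1(L,\mu)$ consist of complex-valued functions. A linear operator $T: C(K)\to L^1(L,\mu)$ is *order-bounded* if for each $0\le f\in C(K)$ there is $0\le h\in L^1(L,\mu)$ with $|Tu|\le h$ for all $u\in C(K)$ with $|u|\le f$. It is *regular* if it is a linear combination of positive operators. For order-bounded $T$, the linear modulus $|T|: C(K)\to L^1(L,\mu)$ is the linear operator with $|T|f=\sup\{|Tg| : g\in C(K),\ |g|\le f\}$ (supremum in the lattice $L^1(L,\mu)$) for all $0\le f\in C(K)$, and $\mu_T\in M(K\times L)$ is the measure with $$\int_{K\times L} f(x)g(y)\,d\mu_T(x,y)=\int_L (Tf)\cdot g\,d\mu\qquad (f\in C(K),\ g\in C(L)).$$ For every order-bounded linear operator $T: C(K)\to L^1(L,\mu)$ the operator $|T|$ and the measures $\mu_T$ and $\mu_{|T|}$ exist and are unique, and $$|\mu_T|=\mu_{|T|}.$$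 Let $\mathcal L^r(C(K),L^1(L,\mu))$ be the space of regular operators, with the modulus $T\mapsto|T|$ and the regular norm $\|T\|_r=\|\,|T|\,\|$ (the operator norm of the linear modulus). Then the map $T\mapsto\mu_T$ is an isometric lattice homomorphism (that is, it is linear, $\|\mu_T\|=\|T\|_r$, and $|\mu_T|=\mu_{|T|}$) from $\mathcal L^r(C(K),L^1(L,\mu))$ onto $$\{\rho\in M(K\times L) : \pi_{L*}|\rho|\in L^1(L,\mu)\},$$ and this set is a closed ideal of $M(K\times L)$, i.e. a norm-closed linear subspace $I$ such that $\sigma\in I$ whenever $\rho\in I$, $\sigma\in M(K\times L)$ and $|\sigma|\le|\rho|$. Here $\pi_L:K\times L\to L$ is the projection, and $L^1(L,\mu)$ is identified with $\{\lambda\in M(L) : |\lambda|\ll\mu\}$. -/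

import Mathlib

open MeasureTheory
open scoped ENNReal NNReal ComplexOrder

noncomputable section

/-! ### Complex regular Borel measures on a compact space -/

/-- A positive measure dominated by a finite regular one is regular. -/
theorem regular_of_le_regular {X : Type*} [TopologicalSpace X] [CompactSpace X] [T2Space X]
    [MeasurableSpace X] [BorelSpace X] {ν m : Measure X} (hle : ν ≤ m) (hm : m.Regular) :
    ν.Regular := by
  have : IsFiniteMeasure m := inferInstance
  have : IsFiniteMeasure ν := isFiniteMeasure_of_le m hle
  have : ν.InnerRegularCompactLTTop := by
    refine ⟨fun A hA r hr => ?_⟩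
    obtain ⟨C, hCA, hC, -, hlt⟩ := hA.1.exists_isCompact_isClosed_sdiff_lt (μ := m)
      (measure_ne_top m A) (tsub_pos_of_lt hr).ne'
    refine ⟨C, hCA, hC, ?_⟩
    by_contra! hcon
    have h1 : ν A ≤ ν (A \ C) + ν C := by
      calc ν A ≤ ν ((A \ C) ∪ C) := measure_mono (by intro x hx; by_cases h : x ∈ C <;> simp [*])
        _ ≤ _ := measure_union_le _ _
    have h2 : ν (A \ C) < ν A - r := (hle _).trans_lt hlt
    have h3 : ν (A \ C) + ν C < (ν A - r) + r :=
      ENNReal.add_lt_add_of_lt_of_le (hcon.trans_lt (hr.trans_le le_top)).ne h2 hcon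
    rw [tsub_add_cancel_of_le hr.le] at h3
    exact absurd h1 (not_le.mpr h3)
  infer_instance

/-- `M(X)`: the complex Borel measures on `X` whose total variation is regular. -/
def regularComplexMeasures (X : Type*) [TopologicalSpace X] [CompactSpace X] [T2Space X]
    [MeasurableSpace X] [BorelSpace X] : Submodule ℂ (ComplexMeasure X) where
  carrier := {ρ | ρ.variation.Regular}
  zero_mem' := by
    simp only [Set.mem_ofPred_eq, VectorMeasure.variation_zero]
    infer_instance
  add_mem' := by
    intro ρ σ hρ hσ
    simp only [Set.mem_ofPred_eq] at hρ hσ ⊢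
    have : (ρ.variation + σ.variation).Regular := by
      have : IsFiniteMeasure ρ.variation := inferInstance
      have : IsFiniteMeasure σ.variation := inferInstance
      infer_instance
    exact regular_of_le_regular VectorMeasure.variation_add_le this
  smul_mem' := by
    intro c ρ hρ
    simp only [Set.mem_ofPred_eq] at hρ ⊢
    rw [VectorMeasure.variation_smul]
    infer_instance

section RegularComplexMeasures

variable {X : Type*} [TopologicalSpace X] [CompactSpace X] [T2Space X]
  [MeasurableSpace X] [BorelSpace X]

instance regularComplexMeasures.variation_regular (ρ : regularComplexMeasures X) :
    (ρ : ComplexMeasure X).variation.Regular := ρ.2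

/-- The norm of `M(X)` is the total variation norm `‖ρ‖ = |ρ|(X)`. -/
instance regularComplexMeasures.instNorm : Norm (regularComplexMeasures X) :=
  ⟨fun ρ => (ρ : ComplexMeasure X).variation.real Set.univ⟩

theorem regularComplexMeasures.norm_def (ρ : regularComplexMeasures X) :
    ‖ρ‖ = (ρ : ComplexMeasure X).variation.real Set.univ := rfl

theorem regularComplexMeasures.core : NormedSpace.Core ℂ (regularComplexMeasures X) where
  norm_nonneg _ := measureReal_nonneg
  norm_smul c ρ := by
    simp [regularComplexMeasures.norm_def, VectorMeasure.variation_smul, measureReal_def]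
  norm_triangle ρ σ := by
    simp only [regularComplexMeasures.norm_def, measureReal_def, Submodule.coe_add]
    rw [← ENNReal.toReal_add (measure_ne_top _ _) (measure_ne_top _ _)]
    refine ENNReal.toReal_mono
      (ENNReal.add_ne_top.mpr ⟨measure_ne_top _ _, measure_ne_top _ _⟩) ?_
    exact VectorMeasure.variation_add_le (μ := (ρ : ComplexMeasure X)) Set.univ
  norm_eq_zero_iff ρ := by
    rw [regularComplexMeasures.norm_def, measureReal_eq_zero_iff, Measure.measure_univ_eq_zero,
      VectorMeasure.variation_eq_zero, Submodule.coe_eq_zero]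

instance regularComplexMeasures.instNormedAddCommGroup :
    NormedAddCommGroup (regularComplexMeasures X) :=
  NormedAddCommGroup.ofCore (𝕜 := ℂ) regularComplexMeasures.core

instance regularComplexMeasures.instNormedSpace : NormedSpace ℂ (regularComplexMeasures X) :=
  NormedSpace.ofCore (𝕜 := ℂ) regularComplexMeasures.core

/-- The absolute value `|ρ| ∈ M(X)` of `ρ ∈ M(X)`: the total variation measure of `ρ`, regarded
as a complex measure. -/
def regularComplexMeasures.modulus (ρ : regularComplexMeasures X) : regularComplexMeasures X :=
  ⟨(ρ : ComplexMeasure X).variation.toSignedMeasure.toComplexMeasure 0, by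
    refine regular_of_le_regular (m := (ρ : ComplexMeasure X).variation) ?_ ρ.2
    refine VectorMeasure.variation_le_of_forall_enorm_le fun E hE => ?_
    have h : (((ρ : ComplexMeasure X).variation.toSignedMeasure.toComplexMeasure 0) E : ℂ)
        = (((ρ : ComplexMeasure X).variation.real E : ℝ) : ℂ) := by
      rw [SignedMeasure.toComplexMeasure_apply, Measure.toSignedMeasure_apply_measurable hE]
      rfl
    rw [h, ← ofReal_norm, Complex.norm_real, Real.norm_of_nonneg measureReal_nonneg,
      measureReal_def, ENNReal.ofReal_toReal (measure_ne_top _ _)]⟩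

/-- A norm-closed ideal of the complex Banach lattice `M(X)`: a closed linear subspace `I` such
that `|σ| ≤ |ρ|` and `ρ ∈ I` imply `σ ∈ I`. -/
structure IsClosedLatticeIdeal (I : Set (regularComplexMeasures X)) : Prop where
  zero_mem : 0 ∈ I
  add_mem : ∀ ρ ∈ I, ∀ σ ∈ I, ρ + σ ∈ I
  smul_mem : ∀ (c : ℂ), ∀ ρ ∈ I, c • ρ ∈ I
  solid : ∀ ρ ∈ I, ∀ σ : regularComplexMeasures X,
    (σ : ComplexMeasure X).variation ≤ (ρ : ComplexMeasure X).variation → σ ∈ I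
  isClosed : IsClosed I

end RegularComplexMeasures

/-! ### Operators `C(K) → L¹(L, μ)` and their linear modulus

The order on `C(K, ℂ)` and on `Lp ℂ 1 μ` is the pointwise (a.e.) one coming from the order of `ℂ`
in which `z ≤ w` means that `w - z` is a nonnegative real number. -/

/-- The absolute value `|u| ∈ L¹` of `u ∈ L¹`. -/
def L1abs {L : Type*} [MeasurableSpace L] {μ : Measure L} (u : Lp ℂ 1 μ) : Lp ℂ 1 μ :=
  ((Lp.memLp u).norm.ofReal (K := ℂ)).toLp (fun x => ((‖u x‖ : ℝ) : ℂ))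

section Operators

variable {K L : Type*} [TopologicalSpace K] [MeasurableSpace L] {μ : Measure L}

/-- `|u| ≤ f` pointwise on `K`. -/
def AbsLE (u f : C(K, ℂ)) : Prop := ∀ x, ((‖u x‖ : ℝ) : ℂ) ≤ f x

/-- `T` is order-bounded. -/
def IsOrderBounded (T : C(K, ℂ) →ₗ[ℂ] Lp ℂ 1 μ) : Prop :=
  ∀ f : C(K, ℂ), 0 ≤ f → ∃ h : Lp ℂ 1 μ, 0 ≤ h ∧ ∀ u : C(K, ℂ), AbsLE u f → L1abs (T u) ≤ h

/-- `T` is positive. -/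
def IsPositiveOperator (T : C(K, ℂ) →ₗ[ℂ] Lp ℂ 1 μ) : Prop :=
  ∀ f : C(K, ℂ), 0 ≤ f → 0 ≤ T f

variable (K μ) in
/-- The space of regular operators, i.e. of linear combinations of positive operators. -/
def regularOperators : Submodule ℂ (C(K, ℂ) →ₗ[ℂ] Lp ℂ 1 μ) :=
  Submodule.span ℂ {T | IsPositiveOperator T}

/-- `S` is the linear modulus of `T`: the linear operator with
`S f = sup {|T g| : |g| ≤ f}` (supremum in the lattice `L¹`) for all `f ≥ 0`. -/
def IsLinearModulus (T S : C(K, ℂ) →ₗ[ℂ] Lp ℂ 1 μ) : Prop :=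
  ∀ f : C(K, ℂ), 0 ≤ f → IsLUB {h | ∃ g : C(K, ℂ), AbsLE g f ∧ h = L1abs (T g)} (S f)

open Classical in
/-- The linear modulus `|T|` (the zero operator if there is none). -/
def linearModulus (T : C(K, ℂ) →ₗ[ℂ] Lp ℂ 1 μ) : C(K, ℂ) →ₗ[ℂ] Lp ℂ 1 μ :=
  if h : ∃ S, IsLinearModulus T S then h.choose else 0

end Operators

/-! ### The representing measure

Here `K × L` carries the Borel `σ`-algebra of the product topology, which in general is larger
than the product of the Borel `σ`-algebras. -/

section Representation

variable {K L : Type*} [TopologicalSpace K] [CompactSpace K] [T2Space K]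
  [TopologicalSpace L] [CompactSpace L] [T2Space L] [MeasurableSpace L]
  [MeasurableSpace (K × L)] [BorelSpace (K × L)] {μ : Measure L}

/-- `∫_{K×L} f(x) g(y) dρ(x,y) = ∫_L (T f) g dμ` for all `f ∈ C(K)` and `g ∈ C(L)`. -/
def Represents (T : C(K, ℂ) →ₗ[ℂ] Lp ℂ 1 μ) (ρ : regularComplexMeasures (K × L)) : Prop :=
  ∀ (f : C(K, ℂ)) (g : C(L, ℂ)),
    (ρ : ComplexMeasure (K × L)).integral (fun p => f p.1 * g p.2) (ContinuousLinearMap.mul ℝ ℂ)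
      = ∫ y, T f y * g y ∂μ

open Classical in
/-- The representing measure `μ_T` of `T` (zero if there is none). -/
def reprMeasure (T : C(K, ℂ) →ₗ[ℂ] Lp ℂ 1 μ) : regularComplexMeasures (K × L) :=
  if h : ∃ ρ, Represents T ρ then h.choose else 0

end Representation

end

set_option linter.unusedSectionVars false

open Filter Topology

/-! ### Complex measures and their densities -/

section Density

variable {X : Type*} [MeasurableSpace X]

/-! From operator to measure: order-boundedness at `f = 1` gives an integrable `h` with `|T f| ≤ ‖f‖
h` for all `f`. Hence `A ↦ (f ↦ ∫_A T f dμ)` is an additive set function with values in the dual of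
`C(K)`, dominated by `ν = h μ`. Integrating `y ↦ F(·, y)` against it yields a bounded functional on
`C(K × L)` that takes `f ⊗ g` to `∫ (T f) g dμ`. The Riesz theorem turns the functional into a
measure `ρ`, and the bound `∫ ‖F(·, y)‖ dν(y)` forces the second marginal of `|ρ|` below `ν`, hence
absolutely continuous (`IsOrderBounded.exists_represents`). Stone–Weierstrass makes `ρ` unique.

From measure to operator: write `ρ = w m` with `m = |ρ|` and `|w| = 1`. If the marginal of `m` is
absolutely continuous, Radon–Nikodym defines `T f` as the density of the image of `f w m` on `L`,
and `S f` as that of `f m`.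

The core is `|T| = S` (`HasDensity.isLinearModulus`). If `|g| ≤ f` then `|g w| ≤ f`, so `|T g| ≤ S
f`. Conversely, let `h` bound all these `|T g|`. For continuous `F` with `|F| ≤ 1`, cut `L` into
finitely many pieces on which `F(·, y)` is nearly a fixed `F(·, c)`; testing `h` with `g = f F(·,
c)` on each piece gives `|∫ f F w dm| ≤ ∫ h dμ` over every strip `K × A`
(`HasDensity.norm_setIntegral_le`). Letting `F` tend to the conjugate of `w` yields `∫_A S f ≤ ∫_A
h`. As `|ρ|` represents `S`, this says `|μ_T| = μ_{|T|}`.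

The rest follows: `S` has norm `m(K × L)`, attained at `f = 1`; `T` is regular because `w` is a
combination of nonnegative densities; and regular operators are order-bounded. -/

/-- Polar decomposition of a complex measure of finite total variation. -/
theorem exists_polar_decomposition (ρ : ComplexMeasure X) [IsFiniteMeasure ρ.variation] :
    ∃ w : X → ℂ, Measurable w ∧ (∀ x, ‖w x‖ = 1) ∧ ρ = ρ.variation.withDensityᵥ w := by
  set m := ρ.variation with hm
  have hac : ρ ≪ᵥ m.toENNRealVectorMeasure := by
    refine VectorMeasure.AbsolutelyContinuous.mk fun s hs h0 => ?_
    rw [Measure.toENNRealVectorMeasure_apply_measurable hs] at h0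
    have := VectorMeasure.enorm_measure_le_variation ρ s
    rw [← hm, h0] at this
    simpa using this
  obtain ⟨hre, him⟩ := (ComplexMeasure.absolutelyContinuous_ennreal_iff _ _).1 hac
  have hre' := (SignedMeasure.absolutelyContinuous_iff_withDensityᵥ_rnDeriv_eq _ _).1 hre
  have him' := (SignedMeasure.absolutelyContinuous_iff_withDensityᵥ_rnDeriv_eq _ _).1 him
  set w₀ := ρ.rnDeriv m with hw₀
  have hint : Integrable w₀ m := ρ.integrable_rnDeriv m
  have hmeas : Measurable w₀ :=
    Complex.equivRealProdCLM.symm.continuous.measurable.comp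
      ((SignedMeasure.measurable_rnDeriv _ _).prodMk (SignedMeasure.measurable_rnDeriv _ _))
  have hρ : ρ = m.withDensityᵥ w₀ := by
    ext s hs
    rw [withDensityᵥ_apply hint hs]
    apply Complex.ext
    · rw [← RCLike.re_eq_complex_re, ← integral_re hint.integrableOn]
      have := DFunLike.congr_fun hre' s
      rw [withDensityᵥ_apply (SignedMeasure.integrable_rnDeriv _ _) hs] at this
      exact this.symm
    · rw [← RCLike.im_eq_complex_im, ← integral_im hint.integrableOn]
      have := DFunLike.congr_fun him' s
      rw [withDensityᵥ_apply (SignedMeasure.integrable_rnDeriv _ _) hs] at this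
      exact this.symm
  -- The variation of `w₀ m` is `|w₀| m`, yet it is `m` itself; so `|w₀| = 1` almost everywhere.
  have hvar : m.withDensity (fun x => ‖w₀ x‖ₑ) = m.withDensity 1 := by
    rw [← Measure.variation_withDensityᵥ hint, ← hρ, withDensity_one]
  have hone : ∀ᵐ x ∂m, ‖w₀ x‖ₑ = 1 :=
    (withDensity_eq_iff (by fun_prop) (by fun_prop) hint.2.ne).1 hvar
  classical
  -- Changing `w₀` to `1` on a null set makes it unimodular everywhere.
  refine ⟨fun x => if ‖w₀ x‖ = 1 then w₀ x else 1, ?_, ?_, ?_⟩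
  · exact Measurable.ite (measurableSet_eq_fun hmeas.norm measurable_const) hmeas measurable_const
  · intro x
    by_cases h : ‖w₀ x‖ = 1 <;> simp [h]
  · conv_lhs => rw [hρ]
    refine WithDensityᵥEq.congr_ae ?_
    filter_upwards [hone] with x hx
    have : ‖w₀ x‖ = 1 := by
      rw [← toReal_enorm, hx]; rfl
    simp [this]

/-- Integration of bounded functions against a complex measure given by a density. -/
theorem integral_withDensityᵥ {m : Measure X} {w : X → ℂ} (hw : Integrable w m)
    {f : X → ℂ} (hf : StronglyMeasurable f) {C : ℝ} (hC : ∀ x, ‖f x‖ ≤ C) :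
    (m.withDensityᵥ w).integral f (ContinuousLinearMap.mul ℝ ℂ) = ∫ x, f x * w x ∂m := by
  have hfin : IsFiniteMeasure (m.withDensityᵥ w).variation := by
    rw [Measure.variation_withDensityᵥ hw]
    exact isFiniteMeasure_withDensity hw.2.ne
  have simple : ∀ s : SimpleFunc X ℂ,
      (m.withDensityᵥ w).integral s (ContinuousLinearMap.mul ℝ ℂ) = ∫ x, s x * w x ∂m := by
    intro s
    have hbdd : ∀ t : SimpleFunc X ℂ, ∃ C, ∀ x, ‖t x‖ ≤ C := fun t => t.exists_forall_norm_le
    have hint : ∀ t : SimpleFunc X ℂ, Integrable t (m.withDensityᵥ w).variation := fun t =>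
      t.integrable_of_isFiniteMeasure
    have hint' : ∀ t : SimpleFunc X ℂ, Integrable (fun x => t x * w x) m := fun t => by
      obtain ⟨C, hC⟩ := hbdd t
      exact hw.bdd_mul t.aestronglyMeasurable (ae_of_all _ hC)
    induction s using SimpleFunc.induction with
    | const c hs =>
      rename_i A
      have h1 : ⇑(SimpleFunc.piecewise A hs (SimpleFunc.const X c) (SimpleFunc.const X 0))
          = A.indicator fun _ => c := by
        ext x; by_cases hx : x ∈ A <;> simp [hx]
      rw [h1, VectorMeasure.integral_eq_setToFun,
        setToFun_indicator_const _ hs (measure_ne_top _ _), transpose_eq_cbmApplyMeasure,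
        cbmApplyMeasure_apply, withDensityᵥ_apply hw hs]
      simp only [ContinuousLinearMap.mul_apply']
      rw [← integral_const_mul, ← integral_indicator hs]
      congr 1
      ext x
      by_cases hx : x ∈ A <;> simp [hx]
    | add _ hf hg =>
      rename_i f g _
      rw [SimpleFunc.coe_add, VectorMeasure.integral_add (hint f) (hint g), hf, hg,
        ← integral_add (hint' f) (hint' g)]
      simp [add_mul]
  wlog hC0 : 0 ≤ C generalizing C
  · exact this (C := |C|) (fun x => (hC x).trans (le_abs_self C)) (abs_nonneg C)
  have l1 : Tendsto (fun n => (m.withDensityᵥ w).integral (hf.approxBounded C n)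
      (ContinuousLinearMap.mul ℝ ℂ)) atTop
      (𝓝 ((m.withDensityᵥ w).integral f (ContinuousLinearMap.mul ℝ ℂ))) :=
    VectorMeasure.tendsto_integral_filter_of_norm_le_const
      (Eventually.of_forall fun n => (hf.approxBounded C n).aestronglyMeasurable)
      ⟨C, Eventually.of_forall fun n => ae_of_all _ (hf.norm_approxBounded_le hC0 n)⟩
      (ae_of_all _ fun x => hf.tendsto_approxBounded_of_norm_le (hC x))
  have l2 : Tendsto (fun n => ∫ x, hf.approxBounded C n x * w x ∂m) atTop
      (𝓝 (∫ x, f x * w x ∂m)) := by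
    refine tendsto_integral_of_dominated_convergence (fun x => C * ‖w x‖)
      (fun n => (hf.approxBounded C n).aestronglyMeasurable.mul hw.1) (hw.norm.const_mul C)
      (fun n => ae_of_all _ fun x => ?_)
      (ae_of_all _ fun x => (hf.tendsto_approxBounded_of_norm_le (hC x)).mul_const _)
    rw [norm_mul]
    exact mul_le_mul_of_nonneg_right (hf.norm_approxBounded_le hC0 n x) (norm_nonneg _)
  simp_rw [simple] at l1
  exact tendsto_nhds_unique l1 l2

/-- If `|∫_A u| ≤ ∫_A v` for all measurable `A`, then `|u| ≤ v` almost everywhere. -/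
theorem ae_norm_le_of_forall_norm_setIntegral_le {m : Measure X} {u : X → ℂ} {v : X → ℝ}
    (hu : Integrable u m) (hv : Integrable v m)
    (h : ∀ A, MeasurableSet A → ‖∫ x in A, u x ∂m‖ ≤ ∫ x in A, v x ∂m) :
    ∀ᵐ x ∂m, ‖u x‖ ≤ v x := by
  have hv0 : 0 ≤ᵐ[m] v := ae_nonneg_of_forall_setIntegral_nonneg hv
    fun A hA _ => (norm_nonneg _).trans (h A hA)
  -- The setwise bound passes to the variation, which is `|u| m`; this moves the modulus inside the
  -- integral.
  have hle : (m.withDensityᵥ u).variation ≤ m.withDensity (fun x => ENNReal.ofReal (v x)) := by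
    refine VectorMeasure.variation_le_of_forall_enorm_le fun A hA => ?_
    rw [withDensityᵥ_apply hu hA, withDensity_apply _ hA,
      ← ofReal_integral_eq_lintegral_ofReal hv.integrableOn (ae_restrict_of_ae hv0),
      ← ofReal_norm]
    exact ENNReal.ofReal_le_ofReal (h A hA)
  rw [Measure.variation_withDensityᵥ hu] at hle
  refine ae_le_of_forall_setIntegral_le hu.norm hv fun A hA _ => ?_
  have h1 := hle A
  rw [withDensity_apply _ hA, withDensity_apply _ hA,
    ← ofReal_integral_eq_lintegral_ofReal hv.integrableOn (ae_restrict_of_ae hv0),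
    ← ofReal_integral_norm_eq_lintegral_enorm hu.integrableOn] at h1
  exact (ENNReal.ofReal_le_ofReal_iff (setIntegral_nonneg_of_ae hv0)).1 h1

end Density

/-! ### Continuous approximation and separation of regular measures -/

section Approximation

variable {X : Type*} [TopologicalSpace X] [CompactSpace X] [T2Space X]
  [MeasurableSpace X] [BorelSpace X]

/-- Lusin-type approximation: a measurable function into the unit disc is an almost everywhere
limit of continuous functions into the unit disc. -/
theorem exists_seq_continuousMap_tendsto_ae (m : Measure X) [m.Regular] {w : X → ℂ}
    (hw : Measurable w) (hw1 : ∀ x, ‖w x‖ ≤ 1) :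
    ∃ F : ℕ → C(X, ℂ), (∀ n x, ‖F n x‖ ≤ 1) ∧
      ∀ᵐ x ∂m, Tendsto (fun n => F n x) atTop (𝓝 (w x)) := by
  have hmem : MemLp w 1 m :=
    MemLp.of_bound hw.aestronglyMeasurable 1 (ae_of_all _ hw1)
  have hex : ∀ n : ℕ, ∃ g : BoundedContinuousFunction X ℂ,
      eLpNorm (w - (g : X → ℂ)) 1 m ≤ ((n : ℝ≥0∞) + 1)⁻¹ ∧ MemLp g 1 m := fun n =>
    hmem.exists_boundedContinuous_eLpNorm_sub_le ENNReal.one_ne_top (by simp)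
  choose g hg hg' using hex
  have hlim : Tendsto (fun n => eLpNorm (⇑(g n) - w) 1 m) atTop (𝓝 0) := by
    refine tendsto_of_tendsto_of_tendsto_of_le_of_le tendsto_const_nhds ?_
      (fun _ => zero_le) (fun n => (eLpNorm_sub_comm _ _ _ _).trans_le (hg n))
    have := (tendsto_add_atTop_iff_nat 1).2 ENNReal.tendsto_inv_nat_nhds_zero
    simpa using this
  obtain ⟨ns, -, hns⟩ := (tendstoInMeasure_of_tendsto_eLpNorm one_ne_zero
    (fun n => (hg' n).1) hmem.1 hlim).exists_seq_tendsto_ae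
  -- The radial retraction onto the closed unit disc truncates the approximants and fixes the values
  -- of `w`, so the limit is unchanged.
  have hcont : Continuous fun z : ℂ => z / ((max 1 ‖z‖ : ℝ) : ℂ) := by
    refine continuous_id.div (by fun_prop) fun z => ?_
    exact_mod_cast (lt_of_lt_of_le one_pos (le_max_left 1 ‖z‖)).ne'
  refine ⟨fun n => ⟨fun x => g (ns n) x / ((max 1 ‖g (ns n) x‖ : ℝ) : ℂ),
    hcont.comp (g (ns n)).continuous⟩, fun n x => ?_, ?_⟩
  · have h0 : 0 < max 1 ‖g (ns n) x‖ := lt_of_lt_of_le one_pos (le_max_left _ _)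
    simp only [ContinuousMap.coe_mk, norm_div, Complex.norm_real, Real.norm_of_nonneg h0.le]
    exact (div_le_one h0).2 (le_max_right _ _)
  · filter_upwards [hns] with x hx
    have h1 := (hcont.tendsto (w x)).comp hx
    have h2 : w x / ((max 1 ‖w x‖ : ℝ) : ℂ) = w x := by
      rw [max_eq_left (hw1 x)]; simp
    rw [h2] at h1
    exact h1

/-- Integrable functions are separated by integration against continuous functions. -/
theorem ae_eq_zero_of_forall_integral_continuousMap_mul {m : Measure X} [m.Regular] {u : X → ℂ}
    (hu : Integrable u m) (h : ∀ g : C(X, ℂ), ∫ x, u x * g x ∂m = 0) : u =ᵐ[m] 0 := by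
  refine hu.ae_eq_zero_of_forall_setIntegral_eq_zero fun A hA _ => ?_
  obtain ⟨F, hF1, hF⟩ := exists_seq_continuousMap_tendsto_ae m (w := A.indicator 1)
    (measurable_one.indicator hA) (fun x => by by_cases hx : x ∈ A <;> simp [hx])
  have hlim : Tendsto (fun n => ∫ x, u x * F n x ∂m) atTop
      (𝓝 (∫ x, u x * A.indicator 1 x ∂m)) := by
    refine tendsto_integral_of_dominated_convergence (fun x => ‖u x‖)
      (fun n => hu.1.mul (F n).continuous.aestronglyMeasurable) hu.norm
      (fun n => ae_of_all _ fun x => ?_) ?_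
    · rw [norm_mul]
      exact mul_le_of_le_one_right (norm_nonneg _) (hF1 n x)
    · filter_upwards [hF] with x hx using hx.const_mul _
  simp_rw [h] at hlim
  have h0 := tendsto_nhds_unique hlim tendsto_const_nhds
  rw [← integral_indicator hA, ← h0]
  congr 1
  ext x
  by_cases hx : x ∈ A <;> simp [hx]

theorem ContinuousMap.integral_withDensityᵥ {m : Measure X} {w : X → ℂ} (hw : Integrable w m)
    (F : C(X, ℂ)) :
    (m.withDensityᵥ w).integral F (ContinuousLinearMap.mul ℝ ℂ) = ∫ x, F x * w x ∂m :=
  _root_.integral_withDensityᵥ hw (F.continuous.stronglyMeasurable_of_hasCompactSupport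
    (HasCompactSupport.of_compactSpace _)) F.norm_coe_le_norm

namespace regularComplexMeasures

theorem exists_polar (ρ : regularComplexMeasures X) :
    ∃ w : X → ℂ, Measurable w ∧ (∀ x, ‖w x‖ = 1) ∧
      (ρ : ComplexMeasure X) = (ρ : ComplexMeasure X).variation.withDensityᵥ w ∧
      Integrable w (ρ : ComplexMeasure X).variation := by
  obtain ⟨w, h1, h2, h3⟩ := exists_polar_decomposition (ρ : ComplexMeasure X)
  exact ⟨w, h1, h2, h3, Integrable.of_bound h1.aestronglyMeasurable 1
    (ae_of_all _ fun x => (h2 x).le)⟩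

/-- A regular complex measure is determined by the integrals of continuous functions. -/
theorem eq_zero_of_forall_integral (ρ : regularComplexMeasures X)
    (h : ∀ F : C(X, ℂ), (ρ : ComplexMeasure X).integral F (ContinuousLinearMap.mul ℝ ℂ) = 0) :
    ρ = 0 := by
  obtain ⟨w, hw, hw1, hρ, hint⟩ := regularComplexMeasures.exists_polar ρ
  have hz : w =ᵐ[(ρ : ComplexMeasure X).variation] 0 := by
    refine ae_eq_zero_of_forall_integral_continuousMap_mul hint fun g => ?_
    have := h g
    rw [hρ, ContinuousMap.integral_withDensityᵥ hint] at this
    simpa [mul_comm] using this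
  have : (ρ : ComplexMeasure X).variation = 0 := by
    rw [← ae_eq_bot, ← Filter.eventually_false_iff_eq_bot]
    filter_upwards [hz] with x hx
    have := hw1 x
    simp [hx] at this
  rw [VectorMeasure.variation_eq_zero] at this
  exact Subtype.ext this

end regularComplexMeasures

end Approximation

/-! ### The Riesz representation theorem for `C(X, ℂ)` -/

section Riesz

variable {X : Type*} [TopologicalSpace X] [CompactSpace X]

/-- The supremum of `|Λ g|` over the continuous `g` with `|g| ≤ f`. -/
noncomputable def dualModulus (Λ : C(X, ℂ) →L[ℂ] ℂ) (f : C(X, ℝ≥0)) : ℝ≥0 :=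
  ⨆ g : {g : C(X, ℂ) // ∀ x, ‖g x‖₊ ≤ f x}, ‖Λ g‖₊

theorem le_dualModulus (Λ : C(X, ℂ) →L[ℂ] ℂ) {f : C(X, ℝ≥0)} {g : C(X, ℂ)}
    (hg : ∀ x, ‖g x‖₊ ≤ f x) : ‖Λ g‖₊ ≤ dualModulus Λ f := by
  refine le_ciSup (f := fun g : {g : C(X, ℂ) // ∀ x, ‖g x‖₊ ≤ f x} => ‖Λ g‖₊) ?_ ⟨g, hg⟩
  obtain ⟨C, hC⟩ := (isCompact_range f.continuous).bddAbove
  refine ⟨‖Λ‖₊ * C, ?_⟩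
  rintro _ ⟨g, rfl⟩
  refine (Λ.le_opNNNorm _).trans ?_
  gcongr
  have : ‖(g : C(X, ℂ))‖ ≤ C :=
    (ContinuousMap.norm_le _ C.2).2 fun x => (g.2 x).trans (hC ⟨x, rfl⟩)
  exact_mod_cast this

theorem dualModulus_le {Λ : C(X, ℂ) →L[ℂ] ℂ} {f : C(X, ℝ≥0)} {c : ℝ≥0}
    (h : ∀ g : C(X, ℂ), (∀ x, ‖g x‖₊ ≤ f x) → ‖Λ g‖₊ ≤ c) : dualModulus Λ f ≤ c := by
  have : Nonempty {g : C(X, ℂ) // ∀ x, ‖g x‖₊ ≤ f x} := ⟨⟨0, by simp⟩⟩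
  exact ciSup_le fun g => h g g.2

/-- Rescaling the competitors gives `≤` for every `c ≠ 0`; the reverse inequality is the same one
for `c⁻¹`. -/
theorem dualModulus_smul (Λ : C(X, ℂ) →L[ℂ] ℂ) (c : ℝ≥0) (f : C(X, ℝ≥0)) :
    dualModulus Λ (c • f) = c * dualModulus Λ f := by
  rcases eq_or_ne c 0 with rfl | hc
  · rw [zero_mul, ← nonpos_iff_eq_zero]
    refine dualModulus_le fun g hg => ?_
    have : g = 0 := by ext x; simpa using hg x
    simp [this]
  · have key : ∀ (c : ℝ≥0), c ≠ 0 → ∀ f : C(X, ℝ≥0),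
        dualModulus Λ (c • f) ≤ c * dualModulus Λ f := by
      intro c hc f
      refine dualModulus_le fun g hg => ?_
      have h1 := le_dualModulus Λ (f := f) (g := ((c⁻¹ : ℝ≥0) : ℂ) • g) (fun x => by
        have := hg x
        simp only [ContinuousMap.smul_apply, smul_eq_mul, nnnorm_mul] at this ⊢
        rw [show ‖((c⁻¹ : ℝ≥0) : ℂ)‖₊ = c⁻¹ by ext; simp]
        exact (inv_mul_le_iff₀ (pos_iff_ne_zero.2 hc)).2 this)
      rw [map_smul, smul_eq_mul, nnnorm_mul,
        show ‖((c⁻¹ : ℝ≥0) : ℂ)‖₊ = c⁻¹ by ext; simp] at h1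
      exact (inv_mul_le_iff₀ (pos_iff_ne_zero.2 hc)).1 h1
    refine le_antisymm (key c hc f) ?_
    have := key c⁻¹ (inv_ne_zero hc) (c • f)
    rw [smul_smul, inv_mul_cancel₀ hc, one_smul] at this
    calc c * dualModulus Λ f ≤ c * (c⁻¹ * dualModulus Λ (c • f)) := by gcongr
      _ = _ := by rw [← mul_assoc, mul_inv_cancel₀ hc, one_mul]

theorem exists_norm_eq_one_mul_eq_norm (z : ℂ) : ∃ c : ℂ, ‖c‖ = 1 ∧ c * z = ‖z‖ := by
  rcases eq_or_ne z 0 with rfl | hz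
  · exact ⟨1, by simp⟩
  · have h0 : (‖z‖ : ℂ) ≠ 0 := by simpa using hz
    refine ⟨‖z‖ / z, by simp [hz], by field_simp⟩

/-- For `≤`, a function `h` with `|h| ≤ f₁ + f₂` is split in the proportion `f₁ : f₂`; the `ε` in
the denominator keeps the parts continuous where `f₁ + f₂` vanishes and costs at most `‖Λ‖ ε`. For
`≥`, competitors for `f₁` and `f₂` are rotated so that their images under `Λ` add without
cancellation. Additivity is what allows the Riesz–Markov–Kakutani theorem to be applied. -/
theorem dualModulus_add (Λ : C(X, ℂ) →L[ℂ] ℂ) (f₁ f₂ : C(X, ℝ≥0)) :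
    dualModulus Λ (f₁ + f₂) = dualModulus Λ f₁ + dualModulus Λ f₂ := by
  refine le_antisymm (dualModulus_le fun h hh => ?_) ?_
  · rw [← NNReal.coe_le_coe]
    have key : ∀ ε : ℝ, 0 < ε → ‖Λ h‖ ≤
        ((dualModulus Λ f₁ + dualModulus Λ f₂ : ℝ≥0) : ℝ) + ‖Λ‖ * ε := by
      intro ε hε
      have hpos : ∀ x, 0 < (f₁ x : ℝ) + f₂ x + ε := fun x => by positivity
      have hne : ∀ x, (((f₁ x : ℝ) + f₂ x + ε : ℝ) : ℂ) ≠ 0 := fun x => by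
        exact_mod_cast (hpos x).ne'
      have hh' : ∀ x, ‖h x‖ ≤ f₁ x + f₂ x := fun x => by exact_mod_cast hh x
      let part (f : C(X, ℝ≥0)) : C(X, ℂ) :=
        ⟨fun x => h x * (((f x : ℝ) / (f₁ x + f₂ x + ε) : ℝ) : ℂ), by
          refine h.continuous.mul (Complex.continuous_ofReal.comp ?_)
          exact Continuous.div (by fun_prop) (by fun_prop) fun x => (hpos x).ne'⟩
      have hpart : ∀ f : C(X, ℝ≥0), ‖Λ (part f)‖₊ ≤ dualModulus Λ f := fun f => by
        refine le_dualModulus Λ fun x => ?_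
        rw [← NNReal.coe_le_coe, coe_nnnorm]
        simp only [part, ContinuousMap.coe_mk, norm_mul, Complex.norm_real]
        rw [Real.norm_of_nonneg (by positivity [hpos x]), mul_div_assoc', div_le_iff₀ (hpos x),
          mul_comm]
        gcongr
        linarith [hh' x]
      have hrest : ‖h - part f₁ - part f₂‖ ≤ ε := by
        refine (ContinuousMap.norm_le _ hε.le).2 fun x => ?_
        have : (h - part f₁ - part f₂) x = h x * ((ε / (f₁ x + f₂ x + ε) : ℝ) : ℂ) := by
          simp only [part, ContinuousMap.sub_apply, ContinuousMap.coe_mk]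
          have := hne x
          push_cast at this ⊢
          field_simp
          ring
        rw [this, norm_mul, Complex.norm_real, Real.norm_of_nonneg (by positivity [hpos x]),
          mul_div_assoc', div_le_iff₀ (hpos x), mul_comm]
        gcongr
        linarith [hh' x]
      calc ‖Λ h‖ = ‖Λ (part f₁) + Λ (part f₂) + Λ (h - part f₁ - part f₂)‖ := by
            rw [← map_add, ← map_add]; congr 2; abel
        _ ≤ ‖Λ (part f₁)‖ + ‖Λ (part f₂)‖ + ‖Λ (h - part f₁ - part f₂)‖ := norm_add₃_le
        _ ≤ _ := by
            push_cast
            gcongr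
            · exact hpart f₁
            · exact hpart f₂
            · exact (Λ.le_opNorm _).trans (by gcongr)
    have hlim : Tendsto (fun ε : ℝ =>
        ((dualModulus Λ f₁ + dualModulus Λ f₂ : ℝ≥0) : ℝ) + ‖Λ‖ * ε) (𝓝[>] 0)
        (𝓝 (((dualModulus Λ f₁ + dualModulus Λ f₂ : ℝ≥0) : ℝ) + ‖Λ‖ * 0)) :=
      ((continuous_const.add (continuous_const.mul continuous_id)).tendsto 0).mono_left
        nhdsWithin_le_nhds
    rw [mul_zero, add_zero] at hlim
    exact ge_of_tendsto hlim (eventually_mem_nhdsWithin.mono fun ε hε => key ε hε)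
  · suffices key : ∀ g₁ : C(X, ℂ), (∀ x, ‖g₁ x‖₊ ≤ f₁ x) → ∀ g₂ : C(X, ℂ),
        (∀ x, ‖g₂ x‖₊ ≤ f₂ x) → ‖Λ g₁‖₊ + ‖Λ g₂‖₊ ≤ dualModulus Λ (f₁ + f₂) by
      have h0 : ∀ g₁ : C(X, ℂ), (∀ x, ‖g₁ x‖₊ ≤ f₁ x) →
          dualModulus Λ f₂ + ‖Λ g₁‖₊ ≤ dualModulus Λ (f₁ + f₂) := fun g₁ hg₁ =>
        (le_tsub_iff_right (by simpa using key g₁ hg₁ 0 (by simp))).1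
          (dualModulus_le fun g₂ hg₂ => le_tsub_of_add_le_left (key g₁ hg₁ g₂ hg₂))
      exact (le_tsub_iff_right (by simpa using h0 0 (by simp))).1
        (dualModulus_le fun g₁ hg₁ => le_tsub_of_add_le_left (h0 g₁ hg₁))
    intro g₁ hg₁ g₂ hg₂
    obtain ⟨c₁, hc₁, h₁⟩ := exists_norm_eq_one_mul_eq_norm (Λ g₁)
    obtain ⟨c₂, hc₂, h₂⟩ := exists_norm_eq_one_mul_eq_norm (Λ g₂)
    have hn₁ : ‖c₁‖₊ = 1 := by ext; simpa using hc₁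
    have hn₂ : ‖c₂‖₊ = 1 := by ext; simpa using hc₂
    have := le_dualModulus Λ (f := f₁ + f₂) (g := c₁ • g₁ + c₂ • g₂) fun x => by
      simp only [ContinuousMap.add_apply, ContinuousMap.smul_apply, smul_eq_mul]
      refine (nnnorm_add_le _ _).trans ?_
      rw [nnnorm_mul, nnnorm_mul, hn₁, hn₂, one_mul, one_mul]
      exact add_le_add (hg₁ x) (hg₂ x)
    rw [map_add, map_smul, map_smul, smul_eq_mul, smul_eq_mul, h₁, h₂] at this
    refine le_trans (le_of_eq ?_) this
    ext
    rw [coe_nnnorm, ← Complex.ofReal_add, Complex.norm_real,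
      Real.norm_of_nonneg (by positivity)]
    simp

variable [T2Space X] [MeasurableSpace X] [BorelSpace X]

/-- A bounded functional on `C(X, ℂ)` is dominated by integration against a finite regular
measure. -/
theorem exists_regular_measure_dominating (Λ : C(X, ℂ) →L[ℂ] ℂ) :
    ∃ m : Measure X, m.Regular ∧ ∀ F : C(X, ℂ), ‖Λ F‖ ≤ ∫ x, ‖F x‖ ∂m := by
  let P : CompactlySupportedContinuousMap X ℝ≥0 →ₗ[ℝ≥0] ℝ≥0 :=
    { toFun := fun f => dualModulus Λ f.toContinuousMap
      map_add' := fun f g => dualModulus_add Λ _ _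
      map_smul' := fun c f => dualModulus_smul Λ c _ }
  refine ⟨NNRealRMK.rieszMeasure P, inferInstance, fun F => ?_⟩
  let f : CompactlySupportedContinuousMap X ℝ≥0 :=
    ⟨⟨fun x => ‖F x‖₊, by fun_prop⟩, HasCompactSupport.of_compactSpace _⟩
  have h1 := NNRealRMK.integral_rieszMeasure P f
  have h2 : ‖Λ F‖₊ ≤ P f := le_dualModulus Λ fun x => le_rfl
  calc ‖Λ F‖ ≤ P f := h2
    _ = _ := h1.symm

/-- **Riesz representation theorem**: a bounded functional on `C(X, ℂ)` is given by integration
against a regular complex measure. -/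
theorem exists_regularComplexMeasure_integral_eq (Λ : C(X, ℂ) →L[ℂ] ℂ) :
    ∃ ρ : regularComplexMeasures X, ∀ F : C(X, ℂ),
      (ρ : ComplexMeasure X).integral F (ContinuousLinearMap.mul ℝ ℂ) = Λ F := by
  obtain ⟨m, hm, hle⟩ := exists_regular_measure_dominating Λ
  have hbound : ∀ F : C(X, ℂ), ‖Λ F‖ ≤ ‖ContinuousMap.toLp (E := ℂ) 1 m ℂ F‖ := fun F => by
    refine (hle F).trans (le_of_eq ?_)
    rw [L1.norm_eq_integral_norm]
    refine integral_congr_ae ?_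
    filter_upwards [ContinuousMap.coeFn_toLp (𝕜 := ℂ) (p := 1) m F] with x hx
    rw [hx]
  have hdense : DenseRange (ContinuousMap.toLp (E := ℂ) 2 m ℂ) :=
    ContinuousMap.toLp_denseRange ℂ m ℂ (by simp)
  -- As `m` is finite, the `L¹` bound implies an `L²` bound, so `Λ` extends to a Hilbert space and
  -- is represented by a vector. The constant is the one from Hölder's inequality.
  have hnorm : ∃ C, ∀ F : C(X, ℂ),
      ‖(Λ : C(X, ℂ) →ₗ[ℂ] ℂ) F‖ ≤
        C * ‖(ContinuousMap.toLp (E := ℂ) 2 m ℂ : C(X, ℂ) →ₗ[ℂ] Lp ℂ 2 m) F‖ := by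
    refine ⟨(m Set.univ ^ (1 / (1 : ℝ≥0∞).toReal - 1 / (2 : ℝ≥0∞).toReal)).toReal, fun F => ?_⟩
    refine (hbound F).trans ?_
    simp only [ContinuousLinearMap.coe_coe, Lp.norm_def]
    rw [eLpNorm_congr_ae (ContinuousMap.coeFn_toLp (𝕜 := ℂ) (p := 1) m F),
      eLpNorm_congr_ae (ContinuousMap.coeFn_toLp (𝕜 := ℂ) (p := 2) m F), ← ENNReal.toReal_mul]
    have hF : MemLp F 2 m := MemLp.of_bound F.continuous.aestronglyMeasurable ‖F‖
      (ae_of_all _ F.norm_coe_le_norm)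
    refine ENNReal.toReal_mono (ENNReal.mul_ne_top (ENNReal.rpow_ne_top_of_nonneg (by norm_num)
      (measure_ne_top _ _)) hF.2.ne) ?_
    rw [mul_comm]
    exact eLpNorm_le_eLpNorm_mul_rpow_measure_univ (by norm_num) hF.1
  set Λ₂ : StrongDual ℂ (Lp ℂ 2 m) := (Λ : C(X, ℂ) →ₗ[ℂ] ℂ).extendOfNorm
    (ContinuousMap.toLp (E := ℂ) 2 m ℂ : C(X, ℂ) →ₗ[ℂ] Lp ℂ 2 m) with hΛ₂
  have hext : ∀ F : C(X, ℂ), Λ₂ (ContinuousMap.toLp (E := ℂ) 2 m ℂ F) = Λ F := fun F =>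
    LinearMap.extendOfNorm_eq hdense hnorm F
  set v := (InnerProductSpace.toDual ℂ (Lp ℂ 2 m)).symm Λ₂ with hv
  -- The inner product is conjugate-linear in its first argument, hence the conjugate.
  set w : X → ℂ := fun x => (starRingEnd ℂ) (v x) with hw
  have hwint : Integrable w m := by
    have h1 : Integrable (v : X → ℂ) m := (Lp.memLp v).integrable (by norm_num)
    refine ⟨Complex.continuous_conj.comp_aestronglyMeasurable h1.1, ?_⟩
    refine h1.2.congr' (ae_of_all _ fun x => by simp [hw])
  have hrep : ∀ F : C(X, ℂ), ∫ x, F x * w x ∂m = Λ F := fun F => by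
    rw [← hext, ← InnerProductSpace.toDual_symm_apply, L2.inner_def]
    refine integral_congr_ae ?_
    filter_upwards [ContinuousMap.coeFn_toLp (𝕜 := ℂ) (p := 2) m F] with x hx
    rw [hx, RCLike.inner_apply]
  -- Testing `|Λ F| ≤ ∫ |F| dm` on continuous functions converging to an indicator gives `|∫_A w dm|
  -- ≤ m(A)`; regularity of `w m` is then inherited from `m`.
  have hvar : (m.withDensityᵥ w).variation ≤ m := by
    refine VectorMeasure.variation_le_of_forall_enorm_le fun A hA => ?_
    obtain ⟨F, hF1, hF⟩ := exists_seq_continuousMap_tendsto_ae m (w := A.indicator 1)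
      (measurable_one.indicator hA) (fun x => by by_cases hx : x ∈ A <;> simp [hx])
    have l1 : Tendsto (fun n => ∫ x, F n x * w x ∂m) atTop
        (𝓝 (∫ x, A.indicator 1 x * w x ∂m)) := by
      refine tendsto_integral_of_dominated_convergence (fun x => ‖w x‖)
        (fun n => (F n).continuous.aestronglyMeasurable.mul hwint.1) hwint.norm
        (fun n => ae_of_all _ fun x => ?_) ?_
      · rw [norm_mul]
        exact mul_le_of_le_one_left (norm_nonneg _) (hF1 n x)
      · filter_upwards [hF] with x hx using hx.mul_const _
    have l2 : Tendsto (fun n => ∫ x, ‖F n x‖ ∂m) atTop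
        (𝓝 (∫ x, ‖A.indicator (1 : X → ℂ) x‖ ∂m)) := by
      refine tendsto_integral_of_dominated_convergence (fun x => 1)
        (fun n => (F n).continuous.norm.aestronglyMeasurable) (integrable_const _)
        (fun n => ae_of_all _ fun x => by simpa using hF1 n x) ?_
      filter_upwards [hF] with x hx using hx.norm
    have h3 : ‖∫ x, A.indicator 1 x * w x ∂m‖ ≤ ∫ x, ‖A.indicator (1 : X → ℂ) x‖ ∂m :=
      le_of_tendsto_of_tendsto l1.norm l2
        (Eventually.of_forall fun n => (congrArg norm (hrep (F n))).trans_le (hle _))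
    have h4 : ∫ x, A.indicator 1 x * w x ∂m = ∫ x in A, w x ∂m := by
      rw [← integral_indicator hA]
      congr 1
      ext x
      by_cases hx : x ∈ A <;> simp [hx]
    have h5 : ∫ x, ‖A.indicator (1 : X → ℂ) x‖ ∂m = m.real A := by
      rw [← integral_indicator_one hA]
      congr 1
      ext x
      by_cases hx : x ∈ A <;> simp [hx]
    rw [withDensityᵥ_apply hwint hA, ← ofReal_norm, ← h4]
    refine (ENNReal.ofReal_le_ofReal (h3.trans h5.le)).trans ?_
    rw [measureReal_def, ENNReal.ofReal_toReal (measure_ne_top _ _)]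
  refine ⟨⟨m.withDensityᵥ w, regular_of_le_regular hvar hm⟩, fun F => ?_⟩
  rw [← hrep]
  exact ContinuousMap.integral_withDensityᵥ hwint F

end Riesz

/-! ### Simple retractions and push-forward densities -/

/-- A continuous function on a compact space is uniformly close to its composition with a simple
function of the space into itself. -/
theorem exists_simpleFunc_dist_comp_lt {L E : Type*} [TopologicalSpace L] [CompactSpace L]
    [MeasurableSpace L] [OpensMeasurableSpace L] [PseudoMetricSpace E] {φ : L → E}
    (hφ : Continuous φ) {ε : ℝ} (hε : 0 < ε) :
    ∃ s : SimpleFunc L L, ∀ y, dist (φ y) (φ (s y)) < ε := by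
  classical
  rcases isEmpty_or_nonempty L with hL | ⟨⟨y₀⟩⟩
  · exact ⟨SimpleFunc.ofIsEmpty, fun y => hL.elim y⟩
  -- The map is built one centre at a time: a new `z` takes over its own `ε`-neighbourhood and the
  -- earlier map is kept elsewhere.
  have key : ∀ t : Finset L, ∃ s : SimpleFunc L L,
      ∀ y, (∃ z ∈ t, dist (φ y) (φ z) < ε) → dist (φ y) (φ (s y)) < ε := by
    intro t
    induction t using Finset.induction_on with
    | empty => exact ⟨SimpleFunc.const L y₀, by simp⟩
    | insert z t _ ih =>
      obtain ⟨s, hs⟩ := ih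
      have hU : MeasurableSet {y | dist (φ y) (φ z) < ε} :=
        (isOpen_lt (by fun_prop) continuous_const).measurableSet
      refine ⟨SimpleFunc.piecewise _ hU (SimpleFunc.const L z) s, fun y hy => ?_⟩
      by_cases h : dist (φ y) (φ z) < ε
      · rw [SimpleFunc.piecewise_apply, if_pos (show y ∈ {y | dist (φ y) (φ z) < ε} from h)]
        exact h
      · rw [SimpleFunc.piecewise_apply, if_neg (show y ∉ {y | dist (φ y) (φ z) < ε} from h)]
        refine hs y ?_
        obtain ⟨z', hz', hlt⟩ := hy
        rcases Finset.mem_insert.1 hz' with rfl | hz'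
        · exact absurd hlt h
        · exact ⟨z', hz', hlt⟩
  obtain ⟨t, -, ht⟩ := isCompact_univ.elim_nhds_subcover (fun z => {y | dist (φ y) (φ z) < ε})
    fun z _ => (isOpen_lt (by fun_prop) continuous_const).mem_nhds (by simpa using hε)
  obtain ⟨s, hs⟩ := key t
  refine ⟨s, fun y => hs y ?_⟩
  simpa using ht (Set.mem_univ y)

section Pushforward

variable {X L : Type*} [MeasurableSpace X] [MeasurableSpace L]

/-- `u` is the density with respect to `μ` of the image under `π` of the complex measure `φ m`. -/
def IsPushforwardDensity (m : Measure X) (π : X → L) (μ : Measure L) (φ : X → ℂ) (u : L → ℂ) :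
    Prop :=
  Integrable u μ ∧ ∀ g : L → ℂ, Measurable g → (∃ C, ∀ y, ‖g y‖ ≤ C) →
    ∫ y, u y * g y ∂μ = ∫ x, φ x * g (π x) ∂m

theorem IsPushforwardDensity.add {m : Measure X} {π : X → L} (hπ : Measurable π) {μ : Measure L}
    {φ ψ : X → ℂ} {u v : L → ℂ} (hφ : Integrable φ m) (hψ : Integrable ψ m)
    (hu : IsPushforwardDensity m π μ φ u) (hv : IsPushforwardDensity m π μ ψ v) :
    IsPushforwardDensity m π μ (fun x => φ x + ψ x) (fun y => u y + v y) := by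
  refine ⟨hu.1.add hv.1, fun g hg hC => ?_⟩
  have h1 := hu.2 g hg hC
  have h2 := hv.2 g hg hC
  obtain ⟨C, hC⟩ := hC
  have hint : ∀ {w : L → ℂ}, Integrable w μ → Integrable (fun y => w y * g y) μ := fun hw =>
    hw.mul_bdd hg.aestronglyMeasurable (ae_of_all _ hC)
  have hint' : ∀ {w : X → ℂ}, Integrable w m → Integrable (fun x => w x * g (π x)) m := fun hw =>
    hw.mul_bdd (hg.comp hπ).aestronglyMeasurable (ae_of_all _ fun x => hC (π x))
  simp_rw [add_mul]
  rw [integral_add (hint hu.1) (hint hv.1), integral_add (hint' hφ) (hint' hψ), h1, h2]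

theorem IsPushforwardDensity.const_mul {m : Measure X} {π : X → L} {μ : Measure L} (c : ℂ)
    {φ : X → ℂ} {u : L → ℂ} (hu : IsPushforwardDensity m π μ φ u) :
    IsPushforwardDensity m π μ (fun x => c * φ x) (fun y => c * u y) := by
  refine ⟨hu.1.const_mul c, fun g hg hC => ?_⟩
  simp_rw [mul_assoc]
  rw [integral_const_mul, integral_const_mul, hu.2 g hg hC]

theorem IsPushforwardDensity.setIntegral {m : Measure X} {π : X → L} (hπ : Measurable π)
    {μ : Measure L} {φ : X → ℂ} {u : L → ℂ} (hu : IsPushforwardDensity m π μ φ u)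
    {A : Set L} (hA : MeasurableSet A) :
    ∫ y in A, u y ∂μ = ∫ x in π ⁻¹' A, φ x ∂m := by
  have := hu.2 (A.indicator 1) (measurable_one.indicator hA)
    ⟨1, fun y => by by_cases hy : y ∈ A <;> simp [hy]⟩
  rw [← integral_indicator hA, ← integral_indicator (hπ hA)]
  convert this using 2
  · ext y; by_cases hy : y ∈ A <;> simp [hy]
  · ext x; by_cases hx : π x ∈ A <;> simp [hx]

theorem IsPushforwardDensity.ae_eq {m : Measure X} {π : X → L} (hπ : Measurable π)
    {μ : Measure L} {φ : X → ℂ} {u v : L → ℂ} (hu : IsPushforwardDensity m π μ φ u)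
    (hv : IsPushforwardDensity m π μ φ v) : u =ᵐ[μ] v :=
  Integrable.ae_eq_of_forall_setIntegral_eq u v hu.1 hv.1 fun A hA _ => by
    rw [hu.setIntegral hπ hA, hv.setIntegral hπ hA]

theorem IsPushforwardDensity.congr_ae {m : Measure X} {π : X → L} {μ : Measure L} {φ : X → ℂ}
    {u v : L → ℂ} (hu : IsPushforwardDensity m π μ φ u) (h : u =ᵐ[μ] v) :
    IsPushforwardDensity m π μ φ v := by
  refine ⟨hu.1.congr h, fun g hg hC => ?_⟩
  rw [← hu.2 g hg hC]
  refine integral_congr_ae ?_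
  filter_upwards [h] with y hy
  rw [hy]

/-- The image of `φ m` is absolutely continuous because that of `m` is; its Radon–Nikodym derivative
is the density. -/
theorem exists_isPushforwardDensity_ofReal {m : Measure X} {π : X → L} (hπ : Measurable π)
    {μ : Measure L} [SigmaFinite μ] (hac : m.map π ≪ μ) {φ : X → ℝ} (hφ : Integrable φ m)
    (hφ0 : ∀ x, 0 ≤ φ x) :
    ∃ u, IsPushforwardDensity m π μ (fun x => (φ x : ℂ)) u := by
  set m' := m.withDensity (fun x => ENNReal.ofReal (φ x)) with hm'
  have hfin : IsFiniteMeasure m' := isFiniteMeasure_withDensity_ofReal hφ.2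
  set ν := m'.map π with hν
  have hνμ : ν ≪ μ := ((withDensity_absolutelyContinuous _ _).map hπ).trans hac
  refine ⟨fun y => ((ν.rnDeriv μ y).toReal : ℂ), Measure.integrable_toReal_rnDeriv.ofReal,
    fun g hg _ => ?_⟩
  have h1 := integral_rnDeriv_smul (f := g) hνμ
  simp only [Complex.real_smul] at h1
  rw [h1, integral_map hπ.aemeasurable hg.aestronglyMeasurable,
    integral_withDensity_eq_integral_toReal_smul₀ hφ.1.aemeasurable.ennreal_ofReal
      (ae_of_all _ fun x => ENNReal.ofReal_lt_top)]
  simp [ENNReal.toReal_ofReal (hφ0 _)]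

theorem exists_isPushforwardDensity {m : Measure X} {π : X → L} (hπ : Measurable π)
    {μ : Measure L} [SigmaFinite μ] (hac : m.map π ≪ μ) {φ : X → ℂ} (hφ : Integrable φ m) :
    ∃ u, IsPushforwardDensity m π μ φ u := by
  have real : ∀ ψ : X → ℝ, Integrable ψ m →
      ∃ u, IsPushforwardDensity m π μ (fun x => (ψ x : ℂ)) u := by
    intro ψ hψ
    obtain ⟨u, hu⟩ := exists_isPushforwardDensity_ofReal hπ hac hψ.pos_part
      fun x => le_max_right _ _
    obtain ⟨v, hv⟩ := exists_isPushforwardDensity_ofReal hπ hac hψ.neg_part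
      fun x => le_max_right _ _
    have key := hu.add hπ hψ.pos_part.ofReal (hψ.neg_part.ofReal.const_mul (-1))
      (hv.const_mul (-1))
    have e : (fun x => ((max (ψ x) 0 : ℝ) : ℂ) + -1 * ((max (-ψ x) 0 : ℝ) : ℂ))
        = fun x => (ψ x : ℂ) := by
      funext x
      rw [neg_one_mul, ← sub_eq_add_neg, ← Complex.ofReal_sub]
      congr 1
      rcases le_total 0 (ψ x) with h | h <;> simp [h]
    exact ⟨_, e ▸ key⟩
  obtain ⟨u, hu⟩ := real _ hφ.re
  obtain ⟨v, hv⟩ := real _ hφ.im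
  have key := hu.add hπ hφ.re.ofReal (hφ.im.ofReal.const_mul Complex.I) (hv.const_mul Complex.I)
  have e : (fun x => ((RCLike.re (φ x) : ℝ) : ℂ) + Complex.I * ((RCLike.im (φ x) : ℝ) : ℂ))
      = φ := by
    funext x
    rw [mul_comm]
    exact Complex.re_add_im (φ x)
  exact ⟨_, e ▸ key⟩

/-- Domination of densities passes to the push-forward. -/
theorem IsPushforwardDensity.ae_norm_le {m : Measure X} {π : X → L} (hπ : Measurable π)
    {μ : Measure L} {φ ψ : X → ℂ} {u v : L → ℂ} (hψ : Integrable ψ m)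
    (hu : IsPushforwardDensity m π μ φ u) (hv : IsPushforwardDensity m π μ ψ v)
    (h : ∀ x, ‖φ x‖ ≤ (ψ x).re) : ∀ᵐ y ∂μ, ‖u y‖ ≤ (v y).re := by
  refine ae_norm_le_of_forall_norm_setIntegral_le hu.1 hv.1.re fun A hA => ?_
  have h1 : ∫ y in A, (v y).re ∂μ = ∫ x in π ⁻¹' A, (ψ x).re ∂m := by
    have e1 := integral_re (𝕜 := ℂ) hv.1.integrableOn (μ := μ.restrict A)
    have e2 := integral_re (𝕜 := ℂ) hψ.integrableOn (μ := m.restrict (π ⁻¹' A))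
    rw [hv.setIntegral hπ hA] at e1
    exact e1.trans e2.symm
  refine le_trans ?_ h1.ge
  rw [hu.setIntegral hπ hA]
  exact norm_integral_le_of_norm_le hψ.re.integrableOn (ae_of_all _ h)

end Pushforward

/-! ### The order of complex `L¹`, read almost everywhere -/

section L1Order

variable {L : Type*} [MeasurableSpace L] {μ : Measure L}

theorem Complex.ofReal_le_iff {r : ℝ} {z : ℂ} : (r : ℂ) ≤ z ↔ r ≤ z.re ∧ z.im = 0 := by
  rw [Complex.le_def]
  simp [eq_comm]

theorem L1abs_coeFn (u : Lp ℂ 1 μ) : L1abs u =ᵐ[μ] fun y => ((‖u y‖ : ℝ) : ℂ) :=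
  MemLp.coeFn_toLp _

/-- Comparable complex numbers have equal imaginary parts, so an upper bound of a modulus is real
almost everywhere. -/
theorem L1abs_le_iff {u h : Lp ℂ 1 μ} :
    L1abs u ≤ h ↔ ∀ᵐ y ∂μ, ‖u y‖ ≤ (h y).re ∧ (h y).im = 0 := by
  rw [← Lp.coeFn_le]
  constructor
  · intro H
    filter_upwards [H, L1abs_coeFn u] with y h1 h2
    rw [h2] at h1
    exact Complex.ofReal_le_iff.1 h1
  · intro H
    filter_upwards [H, L1abs_coeFn u] with y h1 h2
    rw [h2]
    exact Complex.ofReal_le_iff.2 h1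

theorem Lp_nonneg_iff {h : Lp ℂ 1 μ} :
    0 ≤ h ↔ ∀ᵐ y ∂μ, 0 ≤ (h y).re ∧ (h y).im = 0 := by
  rw [← Lp.coeFn_nonneg]
  constructor
  · intro H
    filter_upwards [H] with y h1
    exact Complex.ofReal_le_iff.1 (by simpa using h1)
  · intro H
    filter_upwards [H] with y h1
    simpa using Complex.ofReal_le_iff.2 h1

end L1Order

/-! ### Operators given by a density -/

/-- The fibres of `s` cut `A` into finitely many measurable pieces. It serves both for the
projection `K × L → L` and, with `π = id`, on `L` itself. -/
theorem setIntegral_eq_sum_simpleFunc {X L E : Type*} [MeasurableSpace X] [MeasurableSpace L]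
    [NormedAddCommGroup E] [NormedSpace ℝ E] {m : Measure X} {π : X → L} (hπ : Measurable π)
    (s : SimpleFunc L L) {A : Set L} (hA : MeasurableSet A) {G : X → E} (hG : Integrable G m) :
    ∫ x in π ⁻¹' A, G x ∂m = ∑ c ∈ s.range, ∫ x in π ⁻¹' (A ∩ s ⁻¹' {c}), G x ∂m := by
  rw [← integral_biUnion_finset s.range
    (fun c _ => hπ (hA.inter (s.measurableSet_fiber c))) ?_ fun c _ => hG.integrableOn]
  · congr 2
    ext x
    simp
  · intro c _ d _ hcd
    refine Set.disjoint_left.2 fun x hx hx' => hcd ?_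
    exact hx.2.symm.trans hx'.2

section Operators

variable {K L : Type*} [TopologicalSpace K] [CompactSpace K]
  [TopologicalSpace L] [CompactSpace L] [MeasurableSpace L] [BorelSpace L]
  [MeasurableSpace (K × L)] [BorelSpace (K × L)] {μ : Measure L}

/-- `T f` is the density of the image on `L` of the complex measure `f w m`. -/
def HasDensity (T : C(K, ℂ) →ₗ[ℂ] Lp ℂ 1 μ) (m : Measure (K × L)) (w : K × L → ℂ) : Prop :=
  ∀ f : C(K, ℂ), IsPushforwardDensity m Prod.snd μ (fun p => f p.1 * w p) (T f)

theorem integrable_fst_mul {m : Measure (K × L)} {w : K × L → ℂ} (hw : Integrable w m)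
    (f : C(K, ℂ)) : Integrable (fun p => f p.1 * w p) m :=
  hw.bdd_mul (f.comp ContinuousMap.fst).continuous.aestronglyMeasurable
    (ae_of_all _ fun p => f.norm_coe_le_norm p.1)

omit [CompactSpace K] [CompactSpace L] in
theorem measurable_snd_prod : Measurable (Prod.snd : K × L → L) := continuous_snd.measurable

/-- The densities may be chosen separately for each `f`: almost everywhere uniqueness forces the
choices to be linear. -/
theorem exists_hasDensity [SigmaFinite μ] {m : Measure (K × L)}
    (hac : m.map Prod.snd ≪ μ) {w : K × L → ℂ} (hw : Integrable w m) :
    ∃ T : C(K, ℂ) →ₗ[ℂ] Lp ℂ 1 μ, HasDensity T m w := by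
  have hex : ∀ f : C(K, ℂ), ∃ u : Lp ℂ 1 μ,
      IsPushforwardDensity m Prod.snd μ (fun p => f p.1 * w p) u := fun f => by
    obtain ⟨u, hu⟩ := exists_isPushforwardDensity measurable_snd_prod hac
      (integrable_fst_mul hw f)
    exact ⟨(memLp_one_iff_integrable.2 hu.1).toLp u, hu.congr_ae (MemLp.coeFn_toLp _).symm⟩
  choose T hT using hex
  refine ⟨{ toFun := T, map_add' := fun f g => ?_, map_smul' := fun c f => ?_ }, hT⟩
  · refine Lp.ext (EventuallyEq.trans ?_ (Lp.coeFn_add _ _).symm)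
    refine (hT (f + g)).ae_eq measurable_snd_prod ?_
    have := (hT f).add measurable_snd_prod (integrable_fst_mul hw f) (integrable_fst_mul hw g)
      (hT g)
    simp only [ContinuousMap.add_apply, add_mul]
    exact this
  · refine Lp.ext (EventuallyEq.trans ?_ (Lp.coeFn_smul _ _).symm)
    refine (hT (c • f)).ae_eq measurable_snd_prod ?_
    have := (hT f).const_mul c
    simp only [ContinuousMap.smul_apply, smul_eq_mul, mul_assoc]
    exact this

theorem HasDensity.ae_norm_le {T S : C(K, ℂ) →ₗ[ℂ] Lp ℂ 1 μ} {m : Measure (K × L)}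
    {w v : K × L → ℂ} (hT : HasDensity T m w) (hS : HasDensity S m v) (hv : Integrable v m)
    {u f : C(K, ℂ)} (h : ∀ p, ‖u p.1 * w p‖ ≤ (f p.1 * v p).re) :
    ∀ᵐ y ∂μ, ‖T u y‖ ≤ (S f y).re :=
  (hT u).ae_norm_le measurable_snd_prod (integrable_fst_mul hv f) (hS f) h

/-- A nonnegative density yields a positive operator. -/
theorem HasDensity.isPositiveOperator {T : C(K, ℂ) →ₗ[ℂ] Lp ℂ 1 μ} {m : Measure (K × L)}
    {w : K × L → ℂ} (hT : HasDensity T m w) (hw : Integrable w m) (hw0 : ∀ p, 0 ≤ w p) :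
    IsPositiveOperator T := by
  intro f hf
  rw [Lp_nonneg_iff]
  -- Comparing `f w` with itself gives `|T f| ≤ Re (T f)`, which makes `T f` real and nonnegative.
  have hle : ∀ p : K × L, ‖f p.1 * w p‖ ≤ (f p.1 * w p).re := fun p => by
    have h0 : 0 ≤ f p.1 * w p := mul_nonneg (hf p.1) (hw0 p)
    rw [← Complex.norm_of_nonneg' h0]
    simp
  filter_upwards [hT.ae_norm_le hT hw hle] with y hy
  have h1 : (T f y).re = ‖T f y‖ := le_antisymm (Complex.re_le_norm _) hy
  refine ⟨h1 ▸ norm_nonneg _, ?_⟩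
  have h2 := Complex.sq_norm (T f y)
  rw [Complex.normSq_apply, ← h1] at h2
  nlinarith

/-- The section `y ↦ F(·, y)` of a continuous function on a product. -/
noncomputable def sectionMap (F : C(K × L, ℂ)) : C(L, C(K, ℂ)) := (F.comp ContinuousMap.prodSwap).curry

omit [CompactSpace K] [CompactSpace L] [MeasurableSpace L] [BorelSpace L]
  [MeasurableSpace (K × L)] [BorelSpace (K × L)] in
@[simp] theorem sectionMap_apply (F : C(K × L, ℂ)) (y : L) (x : K) :
    sectionMap F y x = F (x, y) := rfl

/-- If `h` dominates all `|T g|` with `|g| ≤ f`, then it controls the integrals of `f F` for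
continuous `F` on `K × L` with `|F| ≤ 1`. -/
theorem HasDensity.norm_setIntegral_le {T : C(K, ℂ) →ₗ[ℂ] Lp ℂ 1 μ}
    {m : Measure (K × L)} {w : K × L → ℂ} (hw : Integrable w m)
    (hT : HasDensity T m w) {f : C(K, ℂ)} {h : L → ℝ} (hh : Integrable h μ)
    (hf : 0 ≤ f) (hle : ∀ g : C(K, ℂ), AbsLE g f → ∀ᵐ y ∂μ, ‖T g y‖ ≤ h y)
    {F : C(K × L, ℂ)} (hF : ∀ p, ‖F p‖ ≤ 1) {A : Set L} (hA : MeasurableSet A) :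
    ‖∫ p in Prod.snd ⁻¹' A, f p.1 * F p * w p ∂m‖ ≤ ∫ y in A, h y ∂μ := by
  have hFw : Integrable (fun p => F p * w p) m :=
    hw.bdd_mul F.continuous.aestronglyMeasurable (ae_of_all _ hF)
  have key : ∀ ε : ℝ, 0 < ε → ‖∫ p in Prod.snd ⁻¹' A, f p.1 * F p * w p ∂m‖ ≤
      (∫ y in A, h y ∂μ) + ε * (‖f‖ * ∫ p, ‖w p‖ ∂m) := by
    intro ε hε
    -- Closeness is in the norm of `C(K)`: replacing `y` by `s y` changes `F(x, y)` by at most `ε`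
    -- uniformly in `x`.
    obtain ⟨s, hs⟩ := exists_simpleFunc_dist_comp_lt (sectionMap F).continuous hε
    have hclose : ∀ p : K × L, ‖F p - F (p.1, s p.2)‖ ≤ ε := fun p => by
      have h1 := ContinuousMap.dist_apply_le_dist (f := sectionMap F p.2)
        (g := sectionMap F (s p.2)) p.1
      rw [dist_eq_norm] at h1
      exact h1.trans (hs p.2).le
    have hpiece : ∀ c : L, ‖∫ p in Prod.snd ⁻¹' (A ∩ s ⁻¹' {c}), f p.1 * F p * w p ∂m‖ ≤
        (∫ y in A ∩ s ⁻¹' {c}, h y ∂μ) +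
          ∫ p in Prod.snd ⁻¹' (A ∩ s ⁻¹' {c}), ε * (‖f‖ * ‖w p‖) ∂m := by
      intro c
      have hB : MeasurableSet (A ∩ s ⁻¹' {c}) := hA.inter (s.measurableSet_fiber c)
      have hB' := measurable_snd_prod (K := K) hB
      -- On the piece where `s = c`, the function `f F` is nearly this `g` of `x` alone, and `|g| ≤
      -- f` makes it admissible for `h`.
      set g : C(K, ℂ) := f * sectionMap F c with hg
      have hgf : AbsLE g f := fun x => by
        rw [hg, ContinuousMap.mul_apply, norm_mul]
        have h0 := hf x
        have h1 : ‖f x‖ * ‖sectionMap F c x‖ ≤ ‖f x‖ :=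
          mul_le_of_le_one_right (norm_nonneg _) (hF _)
        calc ((‖f x‖ * ‖sectionMap F c x‖ : ℝ) : ℂ) ≤ (‖f x‖ : ℂ) := by exact_mod_cast h1
          _ = f x := Complex.norm_of_nonneg' h0
      have hint : Integrable (fun p => f p.1 * F p * w p) m := by
        simpa only [mul_assoc] using integrable_fst_mul hFw f
      have hsplit : ∫ p in Prod.snd ⁻¹' (A ∩ s ⁻¹' {c}), f p.1 * F p * w p ∂m
          = (∫ p in Prod.snd ⁻¹' (A ∩ s ⁻¹' {c}), g p.1 * w p ∂m) +
            ∫ p in Prod.snd ⁻¹' (A ∩ s ⁻¹' {c}), (f p.1 * F p * w p - g p.1 * w p) ∂m := by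
        rw [integral_sub hint.integrableOn (integrable_fst_mul hw g).integrableOn]
        ring
      rw [hsplit]
      refine (norm_add_le _ _).trans (add_le_add ?_ ?_)
      · rw [← (hT g).setIntegral measurable_snd_prod hB]
        exact norm_integral_le_of_norm_le hh.integrableOn (ae_restrict_of_ae (hle g hgf))
      · refine norm_integral_le_of_norm_le
          ((hw.norm.const_mul ‖f‖).const_mul ε).integrableOn ?_
        filter_upwards [ae_restrict_mem hB'] with p hp
        have hc : s p.2 = c := hp.2
        have h1 := hclose p
        rw [hc] at h1
        have h2 : f p.1 * F p * w p - g p.1 * w p = (F p - F (p.1, c)) * (f p.1 * w p) := by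
          rw [hg, ContinuousMap.mul_apply, sectionMap_apply]
          ring
        rw [h2, norm_mul, norm_mul]
        gcongr
        exact f.norm_coe_le_norm _
    have e0 := setIntegral_eq_sum_simpleFunc (measurable_snd_prod (K := K)) s hA
      (m := m) (G := fun p => f p.1 * F p * w p)
      (by simpa only [mul_assoc] using integrable_fst_mul hFw f)
    have e1 := setIntegral_eq_sum_simpleFunc measurable_id s hA hh
    have e2 := setIntegral_eq_sum_simpleFunc (measurable_snd_prod (K := K)) s hA
      ((hw.norm.const_mul ‖f‖).const_mul ε)
    simp only [Set.preimage_id] at e1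
    rw [e0]
    refine (norm_sum_le _ _).trans ((Finset.sum_le_sum fun c _ => hpiece c).trans ?_)
    rw [Finset.sum_add_distrib, ← e1, ← e2, ← integral_const_mul, ← integral_const_mul]
    refine add_le_add le_rfl ?_
    exact setIntegral_le_integral ((hw.norm.const_mul ‖f‖).const_mul ε)
      (ae_of_all _ fun p => by positivity)
  have hlim : Tendsto (fun ε : ℝ => (∫ y in A, h y ∂μ) + ε * (‖f‖ * ∫ p, ‖w p‖ ∂m)) (𝓝[>] 0)
      (𝓝 ((∫ y in A, h y ∂μ) + 0 * (‖f‖ * ∫ p, ‖w p‖ ∂m))) :=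
    ((continuous_const.add (continuous_id.mul continuous_const)).tendsto 0).mono_left
      nhdsWithin_le_nhds
  rw [zero_mul, add_zero] at hlim
  exact ge_of_tendsto hlim (eventually_mem_nhdsWithin.mono fun ε hε => key ε hε)

variable [T2Space K] [T2Space L]

/-- The linear modulus of an operator with unimodular density `w` with respect to `m` has
density `1`. -/
theorem HasDensity.isLinearModulus {T S : C(K, ℂ) →ₗ[ℂ] Lp ℂ 1 μ}
    {m : Measure (K × L)} [m.Regular] {w : K × L → ℂ} (hw : Measurable w) (hw1 : ∀ p, ‖w p‖ = 1)
    (hT : HasDensity T m w) (hS : HasDensity S m 1) : IsLinearModulus T S := by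
  have hwint : Integrable w m := Integrable.of_bound hw.aestronglyMeasurable 1
    (ae_of_all _ fun p => (hw1 p).le)
  have hone : Integrable (1 : K × L → ℂ) m := integrable_const _
  have hSpos := hS.isPositiveOperator hone fun _ => zero_le_one
  intro f hf
  have hSf := Lp_nonneg_iff.1 (hSpos f hf)
  constructor
  · rintro _ ⟨g, hg, rfl⟩
    rw [L1abs_le_iff]
    have hle : ∀ p : K × L, ‖g p.1 * w p‖ ≤ (f p.1 * (1 : K × L → ℂ) p).re := fun p => by
      rw [norm_mul, hw1, mul_one, Pi.one_apply, mul_one]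
      exact (Complex.ofReal_le_iff.1 (hg p.1)).1
    filter_upwards [hT.ae_norm_le hS hone hle, hSf] with y h1 h2 using ⟨h1, h2.2⟩
  · intro h hh
    have hh' : ∀ g : C(K, ℂ), AbsLE g f → ∀ᵐ y ∂μ, ‖T g y‖ ≤ (h y).re ∧ (h y).im = 0 :=
      fun g hg => L1abs_le_iff.1 (hh ⟨g, hg, rfl⟩)
    have hhint : Integrable (fun y => (h y).re) μ := (L1.integrable_coeFn h).re
    have hSint : Integrable (fun y => (S f y).re) μ := (L1.integrable_coeFn (S f)).re
    -- The conjugate of `w` cancels the phase: `f F n w` tends to `f`, the density of `S f`.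
    obtain ⟨F, hF1, hF⟩ := exists_seq_continuousMap_tendsto_ae m
      (w := fun p => (starRingEnd ℂ) (w p)) (Complex.continuous_conj.measurable.comp hw)
      (fun p => by simp [hw1])
    have hae : ∀ᵐ y ∂μ, (S f y).re ≤ (h y).re := by
      refine ae_le_of_forall_setIntegral_le hSint hhint fun A hA _ => ?_
      have hlim : Tendsto (fun n => ∫ p in Prod.snd ⁻¹' A, f p.1 * F n p * w p ∂m) atTop
          (𝓝 (∫ p in Prod.snd ⁻¹' A, f p.1 * (1 : K × L → ℂ) p ∂m)) := by
        refine tendsto_integral_of_dominated_convergence (fun p => ‖f‖) (fun n => ?_)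
          (integrable_const _) (fun n => ae_of_all _ fun p => ?_) ?_
        · exact (((f.comp ContinuousMap.fst).continuous.mul
            (F n).continuous).aestronglyMeasurable.mul hwint.1).restrict
        · rw [norm_mul, norm_mul, hw1, mul_one]
          calc ‖f p.1‖ * ‖F n p‖ ≤ ‖f p.1‖ :=
                mul_le_of_le_one_right (norm_nonneg _) (hF1 n p)
            _ ≤ ‖f‖ := f.norm_coe_le_norm _
        · filter_upwards [ae_restrict_of_ae hF] with p hp
          have h1 := (hp.const_mul (f p.1)).mul_const (w p)
          have h2 : f p.1 * (starRingEnd ℂ) (w p) * w p = f p.1 * (1 : K × L → ℂ) p := by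
            rw [mul_assoc, mul_comm ((starRingEnd ℂ) (w p)), Complex.mul_conj,
              Complex.normSq_eq_norm_sq, hw1]
            simp
          rwa [h2] at h1
      have hbound : ‖∫ p in Prod.snd ⁻¹' A, f p.1 * (1 : K × L → ℂ) p ∂m‖
          ≤ ∫ y in A, (h y).re ∂μ :=
        le_of_tendsto hlim.norm (Eventually.of_forall fun n =>
          hT.norm_setIntegral_le hwint hhint hf
            (fun g hg => (hh' g hg).mono fun y hy => hy.1) (hF1 n) hA)
      rw [← (hS f).setIntegral measurable_snd_prod hA] at hbound
      refine le_trans (le_of_eq ?_) ((Complex.re_le_norm _).trans hbound)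
      exact integral_re (𝕜 := ℂ) (L1.integrable_coeFn (S f)).integrableOn
    rw [← Lp.coeFn_le]
    -- The competitor `g = 0` is used only to know that `h` is real.
    filter_upwards [hae, hSf, hh' 0 (fun x => by simpa using hf x)] with y h1 h2 h3
    exact Complex.le_def.2 ⟨h1, h2.2.trans h3.2.symm⟩

theorem HasDensity.represents {T : C(K, ℂ) →ₗ[ℂ] Lp ℂ 1 μ} {m : Measure (K × L)}
    {w : K × L → ℂ} (hw : Integrable w m) (hT : HasDensity T m w)
    {ρ : regularComplexMeasures (K × L)} (hρ : (ρ : ComplexMeasure (K × L)) = m.withDensityᵥ w) :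
    Represents T ρ := by
  intro f g
  have h1 := ContinuousMap.integral_withDensityᵥ hw
    (f.comp ContinuousMap.fst * g.comp ContinuousMap.snd)
  have h2 := (hT f).2 g g.continuous.measurable ⟨‖g‖, g.norm_coe_le_norm⟩
  rw [hρ, h2]
  refine h1.trans (integral_congr_ae (ae_of_all _ fun p => ?_))
  change f p.1 * g p.2 * w p = f p.1 * w p * g p.2
  ring

end Operators

/-! ### The representing measure of an order-bounded operator -/

section Representation

variable {K L : Type*} [TopologicalSpace K] [CompactSpace K]
  [TopologicalSpace L] [CompactSpace L] [MeasurableSpace L] [BorelSpace L] {μ : Measure L}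

omit [TopologicalSpace L] [CompactSpace L] [BorelSpace L] in
/-- An order-bounded operator is dominated on the unit ball by an integrable function. -/
theorem IsOrderBounded.exists_integrable_bound {T : C(K, ℂ) →ₗ[ℂ] Lp ℂ 1 μ}
    (hT : IsOrderBounded T) : ∃ h : L → ℝ, Integrable h μ ∧ (∀ y, 0 ≤ h y) ∧
      ∀ f : C(K, ℂ), ∀ᵐ y ∂μ, ‖T f y‖ ≤ ‖f‖ * h y := by
  -- A bound for the order interval of the constant `1` is a bound for the unit ball; every nonzero
  -- `f` is reduced to it by normalisation.
  obtain ⟨h, -, hh⟩ := hT 1 fun x => zero_le_one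
  refine ⟨fun y => ‖h y‖, (L1.integrable_coeFn h).norm, fun y => norm_nonneg _, fun f => ?_⟩
  rcases eq_or_ne f 0 with rfl | hf
  · rw [map_zero]
    filter_upwards [Lp.coeFn_zero ℂ 1 μ] with y hy
    rw [hy]
    simp
  · have hf0 : 0 < ‖f‖ := norm_pos_iff.2 hf
    have h1 := L1abs_le_iff.1 (hh ((‖f‖⁻¹ : ℂ) • f) fun x => by
      have : ‖((‖f‖⁻¹ : ℂ) • f) x‖ ≤ 1 := by
        rw [ContinuousMap.smul_apply, norm_smul, norm_inv, Complex.norm_real, norm_norm]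
        exact (inv_mul_le_one₀ hf0).2 (f.norm_coe_le_norm x)
      simpa using (by exact_mod_cast this : ((‖((‖f‖⁻¹ : ℂ) • f) x‖ : ℝ) : ℂ) ≤ 1))
    rw [map_smul] at h1
    filter_upwards [h1, Lp.coeFn_smul (‖f‖⁻¹ : ℂ) (T f)] with y hy1 hy2
    rw [hy2, Pi.smul_apply, norm_smul, norm_inv, Complex.norm_real, norm_norm,
      inv_mul_le_iff₀ hf0] at hy1
    exact hy1.1.trans (by gcongr; exact Complex.re_le_norm _)

omit [TopologicalSpace L] [CompactSpace L] [BorelSpace L] in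
theorem norm_setIntegral_apply_le {T : C(K, ℂ) →ₗ[ℂ] Lp ℂ 1 μ} {h : L → ℝ}
    (hh : Integrable h μ) (hle : ∀ f : C(K, ℂ), ∀ᵐ y ∂μ, ‖T f y‖ ≤ ‖f‖ * h y)
    (A : Set L) (f : C(K, ℂ)) : ‖∫ y in A, T f y ∂μ‖ ≤ (∫ y in A, h y ∂μ) * ‖f‖ := by
  refine (norm_integral_le_of_norm_le (hh.const_mul ‖f‖).integrableOn
    (ae_restrict_of_ae (hle f))).trans (le_of_eq ?_)
  rw [integral_const_mul, mul_comm]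

/-- The functional `f ↦ ∫_A T f dμ`. -/
noncomputable def setIntegralFunctional (T : C(K, ℂ) →ₗ[ℂ] Lp ℂ 1 μ) {h : L → ℝ} (hh : Integrable h μ)
    (hle : ∀ f : C(K, ℂ), ∀ᵐ y ∂μ, ‖T f y‖ ≤ ‖f‖ * h y) (A : Set L) : C(K, ℂ) →L[ℂ] ℂ :=
  LinearMap.mkContinuous
    { toFun := fun f => ∫ y in A, T f y ∂μ
      map_add' := fun f g => by
        rw [map_add, ← integral_add (L1.integrable_coeFn (T f)).integrableOn
          (L1.integrable_coeFn (T g)).integrableOn]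
        exact integral_congr_ae (ae_restrict_of_ae (Lp.coeFn_add _ _))
      map_smul' := fun c f => by
        rw [map_smul, RingHom.id_apply, ← integral_smul]
        exact integral_congr_ae (ae_restrict_of_ae (Lp.coeFn_smul _ _)) }
    (∫ y in A, h y ∂μ) (norm_setIntegral_apply_le hh hle A)

omit [TopologicalSpace L] [CompactSpace L] [BorelSpace L] in
-- Since `|∫_A T f dμ| ≤ ‖f‖ ∫_A h dμ`, the functional attached to `A` has norm at most the mass of
-- `A` under `h μ`. This is what permits integrating `C(K)`-valued functions against the set
-- function.
theorem dominatedFinMeasAdditive_setIntegralFunctional (T : C(K, ℂ) →ₗ[ℂ] Lp ℂ 1 μ) {h : L → ℝ}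
    (hh : Integrable h μ) (h0 : ∀ y, 0 ≤ h y)
    (hle : ∀ f : C(K, ℂ), ∀ᵐ y ∂μ, ‖T f y‖ ≤ ‖f‖ * h y) :
    DominatedFinMeasAdditive (μ.withDensity fun y => ENNReal.ofReal (h y))
      (fun A => (setIntegralFunctional T hh hle A).restrictScalars ℝ) 1 := by
  refine ⟨fun A B hA hB _ _ hAB => ?_, fun A hA _ => ?_⟩
  · ext f
    exact setIntegral_union hAB hB (L1.integrable_coeFn (T f)).integrableOn
      (L1.integrable_coeFn (T f)).integrableOn
  · rw [one_mul, measureReal_def, withDensity_apply _ hA,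
      ← ofReal_integral_eq_lintegral_ofReal hh.integrableOn (ae_of_all _ h0),
      ENNReal.toReal_ofReal (integral_nonneg h0), ContinuousLinearMap.norm_restrictScalars]
    exact LinearMap.mkContinuous_norm_le _ (integral_nonneg h0) _

/-- For an indicator in place of `g` this is `hτ`; linearity gives simple functions, and bounded
simple approximation with dominated convergence on both sides gives continuous `g`. -/
theorem setToFun_smul_const_eq_integral {T : C(K, ℂ) →ₗ[ℂ] Lp ℂ 1 μ}
    {ν : Measure L} [IsFiniteMeasure ν] {τ : Set L → C(K, ℂ) →L[ℝ] ℂ}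
    (hdom : DominatedFinMeasAdditive ν τ 1)
    (hτ : ∀ A (c : ℂ) (f : C(K, ℂ)), τ A (c • f) = c * ∫ y in A, T f y ∂μ)
    (f : C(K, ℂ)) (g : C(L, ℂ)) :
    setToFun ν τ hdom (fun y => g y • f) = ∫ y, T f y * g y ∂μ := by
  have hTf := L1.integrable_coeFn (T f)
  have simple : ∀ t : SimpleFunc L ℂ,
      setToFun ν τ hdom (fun y => t y • f) = ∫ y, T f y * t y ∂μ := by
    have hi : ∀ t : SimpleFunc L ℂ, Integrable (fun y => t y • f) ν := fun t =>
      t.integrable_of_isFiniteMeasure.smul_const f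
    have hi' : ∀ t : SimpleFunc L ℂ, Integrable (fun y => T f y * t y) μ := fun t => by
      obtain ⟨C, hC⟩ := t.exists_forall_norm_le
      exact hTf.mul_bdd t.aestronglyMeasurable (ae_of_all _ hC)
    intro t
    induction t using SimpleFunc.induction with
    | const c hA =>
      rename_i A
      have h1 : (fun y => (SimpleFunc.piecewise A hA (SimpleFunc.const L c)
          (SimpleFunc.const L 0)) y • f) = A.indicator fun _ => c • f := by
        ext1 y; by_cases hy : y ∈ A <;> simp [hy]
      rw [h1, setToFun_indicator_const _ hA (measure_ne_top _ _)]
      rw [hτ, ← integral_const_mul, ← integral_indicator hA]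
      congr 1
      ext y
      by_cases hy : y ∈ A <;> simp [hy, mul_comm]
    | add _ hs ht =>
      rename_i s t _
      have h1 : (fun y => (s + t) y • f) = (fun y => s y • f) + fun y => t y • f := by
        ext1 y; simp [add_smul]
      rw [h1, setToFun_add hdom (hi s) (hi t), hs, ht, ← integral_add (hi' s) (hi' t)]
      simp [mul_add]
  have hg : StronglyMeasurable g := g.continuous.stronglyMeasurable_of_hasCompactSupport
    (HasCompactSupport.of_compactSpace _)
  have l1 : Tendsto (fun n => setToFun ν τ hdom (fun y => hg.approxBounded ‖g‖ n y • f)) atTop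
      (𝓝 (setToFun ν τ hdom (fun y => g y • f))) := by
    refine tendsto_setToFun_of_dominated_convergence hdom (fun y => ‖g‖ * ‖f‖)
      (fun n => (hg.approxBounded ‖g‖ n).aestronglyMeasurable.smul_const f)
      (integrable_const _) (fun n => ae_of_all _ fun y => ?_) (ae_of_all _ fun y =>
        (hg.tendsto_approxBounded_of_norm_le (g.norm_coe_le_norm y)).smul_const f)
    rw [norm_smul]
    exact mul_le_mul_of_nonneg_right (hg.norm_approxBounded_le (norm_nonneg _) n y)
      (norm_nonneg _)
  have l2 : Tendsto (fun n => ∫ y, T f y * hg.approxBounded ‖g‖ n y ∂μ) atTop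
      (𝓝 (∫ y, T f y * g y ∂μ)) := by
    refine tendsto_integral_of_dominated_convergence (fun y => ‖T f y‖ * ‖g‖)
      (fun n => hTf.1.mul (hg.approxBounded ‖g‖ n).aestronglyMeasurable)
      (hTf.norm.mul_const _) (fun n => ae_of_all _ fun y => ?_) (ae_of_all _ fun y =>
        (hg.tendsto_approxBounded_of_norm_le (g.norm_coe_le_norm y)).const_mul _)
    rw [norm_mul]
    exact mul_le_mul_of_nonneg_left (hg.norm_approxBounded_le (norm_nonneg _) n y)
      (norm_nonneg _)
  simp_rw [simple] at l1
  exact tendsto_nhds_unique l1 l2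

/-- `C(K)` need not be separable; strong measurability comes from continuity on the compact space
`L`. -/
theorem integrable_sectionMap {ν : Measure L} [IsFiniteMeasure ν] (F : C(K × L, ℂ)) :
    Integrable (sectionMap F) ν :=
  Integrable.of_bound ((sectionMap F).continuous.stronglyMeasurable_of_hasCompactSupport
    (HasCompactSupport.of_compactSpace _)).aestronglyMeasurable ‖sectionMap F‖
    (ae_of_all _ (sectionMap F).norm_coe_le_norm)

theorem norm_sectionMap_apply_le (F : C(K × L, ℂ)) (y : L) : ‖sectionMap F y‖ ≤ ‖F‖ :=
  (ContinuousMap.norm_le _ (norm_nonneg _)).2 fun x => F.norm_coe_le_norm (x, y)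

/-- A dominated additive set function with values in the dual of `C(K)` induces a bounded
functional on `C(K × L)`. -/
theorem exists_functional_eq_setToFun {ν : Measure L} [IsFiniteMeasure ν]
    {τ : Set L → C(K, ℂ) →L[ℝ] ℂ} (hdom : DominatedFinMeasAdditive ν τ 1)
    (hτ : ∀ (c : ℂ) A (f : C(K, ℂ)), τ A (c • f) = c • τ A f) :
    ∃ Λ : C(K × L, ℂ) →L[ℂ] ℂ, (∀ F, Λ F = setToFun ν τ hdom (sectionMap F)) ∧
      ∀ F, ‖Λ F‖ ≤ ∫ y, ‖sectionMap F y‖ ∂ν := by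
  have hbound : ∀ F : C(K × L, ℂ), ‖setToFun ν τ hdom (sectionMap F)‖
      ≤ ∫ y, ‖sectionMap F y‖ ∂ν := fun F => by
    have := norm_setToFun_le hdom (integrable_sectionMap F) zero_le_one
    rwa [one_mul, L1.norm_of_fun_eq_integral_norm] at this
  refine ⟨LinearMap.mkContinuous
    { toFun := fun F => setToFun ν τ hdom (sectionMap F)
      map_add' := fun F G => setToFun_add hdom (integrable_sectionMap F) (integrable_sectionMap G)
      map_smul' := fun c F => setToFun_smul hdom hτ c (sectionMap F) }
    (ν.real Set.univ) fun F => ?_, fun F => rfl, hbound⟩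
  refine (hbound F).trans ((integral_mono (integrable_sectionMap F).norm (integrable_const ‖F‖)
    (norm_sectionMap_apply_le F)).trans ?_)
  rw [integral_const, smul_eq_mul]

/-- A dominated operator `T` extends to a bounded functional `Λ` on `C(K × L)` with
`Λ(f ⊗ g) = ∫ (T f) g dμ`. -/
theorem exists_functional_of_dominated (T : C(K, ℂ) →ₗ[ℂ] Lp ℂ 1 μ) {h : L → ℝ}
    (hh : Integrable h μ) (h0 : ∀ y, 0 ≤ h y)
    (hle : ∀ f : C(K, ℂ), ∀ᵐ y ∂μ, ‖T f y‖ ≤ ‖f‖ * h y) :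
    ∃ Λ : C(K × L, ℂ) →L[ℂ] ℂ,
      (∀ F, ‖Λ F‖ ≤ ∫ y, ‖sectionMap F y‖ ∂μ.withDensity fun y => ENNReal.ofReal (h y)) ∧
      ∀ (f : C(K, ℂ)) (g : C(L, ℂ)),
        Λ (f.comp ContinuousMap.fst * g.comp ContinuousMap.snd) = ∫ y, T f y * g y ∂μ := by
  have hfin : IsFiniteMeasure (μ.withDensity fun y => ENNReal.ofReal (h y)) :=
    isFiniteMeasure_withDensity_ofReal hh.2
  have hdom := dominatedFinMeasAdditive_setIntegralFunctional T hh h0 hle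
  have hτ : ∀ (c : ℂ) A (f : C(K, ℂ)),
      (setIntegralFunctional T hh hle A).restrictScalars ℝ (c • f)
        = c • (setIntegralFunctional T hh hle A).restrictScalars ℝ f := fun c A f =>
    (setIntegralFunctional T hh hle A).map_smul c f
  obtain ⟨Λ, hΛ, hΛ'⟩ := exists_functional_eq_setToFun hdom hτ
  refine ⟨Λ, hΛ', fun f g => ?_⟩
  have hsec : ⇑(sectionMap (f.comp ContinuousMap.fst * g.comp ContinuousMap.snd))
      = fun y => g y • f := by
    ext y x
    exact mul_comm _ _
  rw [hΛ, hsec]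
  exact setToFun_smul_const_eq_integral hdom (fun A c f => hτ c A f) f g

variable [T2Space K] [T2Space L] [MeasurableSpace (K × L)] [BorelSpace (K × L)]

/-- The second marginal of the total variation of a measure whose integrals are controlled by
`∫ ‖F(·, y)‖ dν(y)` is at most `ν`. -/
theorem map_snd_variation_le {ρ : regularComplexMeasures (K × L)} {ν : Measure L} [ν.Regular]
    (h : ∀ F : C(K × L, ℂ), ‖(ρ : ComplexMeasure (K × L)).integral F (ContinuousLinearMap.mul ℝ ℂ)‖
      ≤ ∫ y, ‖sectionMap F y‖ ∂ν) :
    (ρ : ComplexMeasure (K × L)).variation.map Prod.snd ≤ ν := by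
  obtain ⟨w, hw, hw1, hρ, hwint⟩ := regularComplexMeasures.exists_polar ρ
  set m := (ρ : ComplexMeasure (K × L)).variation with hm
  have hsnd : Measurable (Prod.snd : K × L → L) := measurable_snd_prod
  obtain ⟨F, hF1, hF⟩ := exists_seq_continuousMap_tendsto_ae m
    (w := fun p => (starRingEnd ℂ) (w p)) (Complex.continuous_conj.measurable.comp hw)
    (fun p => by simp [hw1])
  -- The test functions `F n (x, y) |g(y)|` have sections of norm at most `|g(y)|`, while their
  -- integrals against `ρ = w m` tend to `∫ |g(y)| dm`.
  have hcont : ∀ g : C(L, ℂ), ∫ y, ‖g y‖ ∂(m.map Prod.snd) ≤ ∫ y, ‖g y‖ ∂ν := by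
    intro g
    rw [integral_map hsnd.aemeasurable g.continuous.norm.aestronglyMeasurable]
    let n' : C(K × L, ℂ) := ⟨fun p => ((‖g p.2‖ : ℝ) : ℂ), by fun_prop⟩
    have hlim : Tendsto (fun n => ∫ p, (F n * n') p * w p ∂m) atTop
        (𝓝 (∫ p, ((‖g p.2‖ : ℝ) : ℂ) ∂m)) := by
      refine tendsto_integral_of_dominated_convergence (fun p => ‖g‖)
        (fun n => (F n * n').continuous.aestronglyMeasurable.mul hwint.1)
        (integrable_const _) (fun n => ae_of_all _ fun p => ?_) ?_
      · rw [norm_mul, ContinuousMap.mul_apply, norm_mul, hw1, mul_one]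
        refine (mul_le_of_le_one_left (norm_nonneg _) (hF1 n p)).trans ?_
        simpa [n'] using g.norm_coe_le_norm p.2
      · filter_upwards [hF] with p hp
        have h1 := (hp.mul_const (n' p)).mul_const (w p)
        have h2 : (starRingEnd ℂ) (w p) * n' p * w p = ((‖g p.2‖ : ℝ) : ℂ) := by
          rw [mul_right_comm, mul_comm ((starRingEnd ℂ) (w p)), Complex.mul_conj,
            Complex.normSq_eq_norm_sq, hw1]
          simp [n']
        rwa [h2] at h1
    have hle : ‖∫ p, ((‖g p.2‖ : ℝ) : ℂ) ∂m‖ ≤ ∫ y, ‖g y‖ ∂ν := by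
      refine le_of_tendsto hlim.norm (Eventually.of_forall fun n => ?_)
      have h1 := h (F n * n')
      rw [hρ, ContinuousMap.integral_withDensityᵥ hwint] at h1
      refine h1.trans (integral_mono_of_nonneg (ae_of_all _ fun y => norm_nonneg _) ?_
        (ae_of_all _ fun y => ?_))
      · exact Integrable.of_bound g.continuous.norm.aestronglyMeasurable ‖g‖
          (ae_of_all _ fun y => by simpa using g.norm_coe_le_norm y)
      · refine (ContinuousMap.norm_le _ (norm_nonneg _)).2 fun x => ?_
        rw [sectionMap_apply, ContinuousMap.mul_apply, norm_mul]
        refine (mul_le_of_le_one_left (norm_nonneg _) (hF1 n _)).trans ?_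
        simp [n']
    rw [integral_complex_ofReal, Complex.norm_real] at hle
    exact (le_abs_self _).trans hle
  have hreg : (m.map Prod.snd).Regular := by
    have : (m.map (Prod.snd : K × L → L)).InnerRegularCompactLTTop :=
      Measure.InnerRegularCompactLTTop.map_of_continuous continuous_snd
    infer_instance
  have hfin : IsFiniteMeasure (m.map (Prod.snd : K × L → L)) := inferInstance
  refine Measure.le_iff.2 fun A hA => ?_
  -- Approximating with respect to the sum makes one sequence converge almost everywhere for both
  -- measures.
  obtain ⟨G, hG1, hG⟩ := exists_seq_continuousMap_tendsto_ae (m.map Prod.snd + ν)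
    (w := A.indicator 1) (measurable_one.indicator hA)
    (fun x => by by_cases hx : x ∈ A <;> simp [hx])
  have hlim : ∀ κ : Measure L, IsFiniteMeasure κ → κ ≪ m.map Prod.snd + ν →
      Tendsto (fun n => ∫ y, ‖G n y‖ ∂κ) atTop (𝓝 (κ.real A)) := by
    intro κ _ hκ
    have h5 : ∫ x, ‖A.indicator (1 : L → ℂ) x‖ ∂κ = κ.real A := by
      rw [← integral_indicator_one hA]
      congr 1
      ext x
      by_cases hx : x ∈ A <;> simp [hx]
    rw [← h5]
    refine tendsto_integral_of_dominated_convergence (fun x => 1)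
      (fun n => (G n).continuous.norm.aestronglyMeasurable) (integrable_const _)
      (fun n => ae_of_all _ fun x => by simpa using hG1 n x) ?_
    filter_upwards [hκ hG] with x hx using hx.norm
  have h1 := le_of_tendsto_of_tendsto
    (hlim _ hfin (Measure.absolutelyContinuous_of_le (Measure.le_add_right le_rfl)))
    (hlim ν inferInstance (Measure.absolutelyContinuous_of_le (Measure.le_add_left le_rfl)))
    (Eventually.of_forall fun n => hcont (G n))
  rw [measureReal_def, measureReal_def] at h1
  exact (ENNReal.toReal_le_toReal (measure_ne_top _ _) (measure_ne_top _ _)).1 h1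

end Representation

/-! ### Existence and uniqueness of representing measures and linear moduli -/

/-- A finite measure with a density with respect to a finite regular measure is regular. -/
theorem regular_withDensity {X : Type*} [TopologicalSpace X] [CompactSpace X] [T2Space X]
    [MeasurableSpace X] [BorelSpace X] {m : Measure X} [m.Regular] {f : X → ℝ≥0∞}
    (hf : ∫⁻ x, f x ∂m ≠ ∞) : (m.withDensity f).Regular := by
  have : IsFiniteMeasure (m.withDensity f) := isFiniteMeasure_withDensity hf
  set ν := m.withDensity f with hν
  have : ν.InnerRegularCompactLTTop := by
    refine ⟨fun A hA r hr => ?_⟩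
    -- Absolute continuity of the integral: a compact subset missing less than `δ` of the `m`-mass
    -- of `A` misses less than `ν A - r` of its `ν`-mass.
    obtain ⟨δ, hδ, hδ'⟩ := exists_pos_setLIntegral_lt_of_measure_lt hf (tsub_pos_of_lt hr).ne'
    obtain ⟨C, hCA, hC, hCc, hlt⟩ := hA.1.exists_isCompact_isClosed_sdiff_lt
      (measure_ne_top m A) hδ.ne'
    refine ⟨C, hCA, hC, ?_⟩
    by_contra! hcon
    have h1 : ν A ≤ ν (A \ C) + ν C :=
      (measure_mono (Set.sdiff_union_of_subset hCA).ge).trans (measure_union_le _ _)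
    have h2 : ν (A \ C) < ν A - r := by
      rw [hν, withDensity_apply _ (hA.1.diff hCc.measurableSet)]
      exact hδ' _ hlt
    have h3 : ν (A \ C) + ν C < (ν A - r) + r :=
      ENNReal.add_lt_add_of_lt_of_le (hcon.trans_lt (hr.trans_le le_top)).ne h2 hcon
    rw [tsub_add_cancel_of_le hr.le] at h3
    exact absurd h1 (not_le.mpr h3)
  infer_instance

theorem regularComplexMeasures.exists_functional {X : Type*} [TopologicalSpace X] [CompactSpace X]
    [T2Space X] [MeasurableSpace X] [BorelSpace X] (ρ : regularComplexMeasures X) :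
    ∃ Λ : C(X, ℂ) →L[ℂ] ℂ, ∀ F : C(X, ℂ),
      Λ F = (ρ : ComplexMeasure X).integral F (ContinuousLinearMap.mul ℝ ℂ) := by
  obtain ⟨w, hw, hw1, hρ, hwint⟩ := regularComplexMeasures.exists_polar ρ
  have hint : ∀ F : C(X, ℂ), Integrable (fun x => F x * w x) (ρ : ComplexMeasure X).variation :=
    fun F => hwint.bdd_mul F.continuous.aestronglyMeasurable (ae_of_all _ F.norm_coe_le_norm)
  refine ⟨LinearMap.mkContinuous
    { toFun := fun F => ∫ x, F x * w x ∂(ρ : ComplexMeasure X).variation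
      map_add' := fun F G => by
        rw [← integral_add (hint F) (hint G)]
        simp [add_mul]
      map_smul' := fun c F => by
        simp [mul_assoc, integral_const_mul] }
    ((ρ : ComplexMeasure X).variation.real Set.univ) fun F => ?_, fun F => ?_⟩
  · refine (norm_integral_le_of_norm_le_const (C := ‖F‖) (ae_of_all _ fun x => ?_)).trans
      (le_of_eq (mul_comm _ _))
    rw [norm_mul, hw1, mul_one]
    exact F.norm_coe_le_norm x
  · conv_rhs => rw [hρ, ContinuousMap.integral_withDensityᵥ hwint]
    rfl

theorem exists_continuousMap_apply_ne {X : Type*} [TopologicalSpace X] [CompactSpace X] [T2Space X]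
    {a b : X} (hab : a ≠ b) : ∃ f : C(X, ℂ), f a ≠ f b := by
  obtain ⟨f, hfa, hfb, -⟩ := exists_continuous_zero_one_of_isClosed
    (isClosed_singleton (x := a)) (isClosed_singleton (x := b)) (by simpa using hab)
  refine ⟨⟨fun z => (f z : ℂ), by fun_prop⟩, ?_⟩
  have ha : f a = 0 := hfa rfl
  have hb : f b = 1 := hfb rfl
  simp [ha, hb]

/-- Two functionals on `C(K × L)` which agree on products `f ⊗ g` are equal. -/
theorem ContinuousMap.functional_ext_of_prod {K L : Type*} [TopologicalSpace K] [CompactSpace K]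
    [T2Space K] [TopologicalSpace L] [CompactSpace L] [T2Space L] {Λ Λ' : C(K × L, ℂ) →L[ℂ] ℂ}
    (h : ∀ (f : C(K, ℂ)) (g : C(L, ℂ)), Λ (f.comp ContinuousMap.fst * g.comp ContinuousMap.snd)
      = Λ' (f.comp ContinuousMap.fst * g.comp ContinuousMap.snd)) : Λ = Λ' := by
  -- The products are closed under multiplication, so the algebra they generate is their linear
  -- span. Agreement on products thus extends by linearity to a self-adjoint point-separating
  -- algebra, which is dense by Stone–Weierstrass.
  let M : Submonoid C(K × L, ℂ) :=
    { carrier := {F | ∃ (f : C(K, ℂ)) (g : C(L, ℂ)),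
        F = f.comp ContinuousMap.fst * g.comp ContinuousMap.snd}
      one_mem' := ⟨1, 1, by ext; simp⟩
      mul_mem' := by
        rintro _ _ ⟨f, g, rfl⟩ ⟨f', g', rfl⟩
        exact ⟨f * f', g * g', by ext p; simp; ring⟩ }
  have hstar : ∀ F ∈ Algebra.adjoin ℂ (M : Set C(K × L, ℂ)),
      star F ∈ Algebra.adjoin ℂ (M : Set C(K × L, ℂ)) := by
    intro F hF
    induction hF using Algebra.adjoin_induction with
    | mem F hF =>
      obtain ⟨f, g, rfl⟩ := hF
      exact Algebra.subset_adjoin ⟨star f, star g, by ext p; simp⟩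
    | algebraMap r =>
      have : star (algebraMap ℂ C(K × L, ℂ) r) = algebraMap ℂ C(K × L, ℂ) (star r) := by
        ext; simp
      rw [this]
      exact Subalgebra.algebraMap_mem _ _
    | add F G _ _ hF hG => rw [star_add]; exact add_mem hF hG
    | mul F G _ _ hF hG => rw [star_mul]; exact mul_mem hG hF
  let A : StarSubalgebra ℂ C(K × L, ℂ) :=
    { Algebra.adjoin ℂ (M : Set C(K × L, ℂ)) with star_mem' := fun hF => hstar _ hF }
  have hsep : A.SeparatesPoints := by
    intro p q hpq
    have hM : ∀ (f : C(K, ℂ)) (g : C(L, ℂ)),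
        f.comp ContinuousMap.fst * g.comp ContinuousMap.snd ∈ A := fun f g =>
      Algebra.subset_adjoin ⟨f, g, rfl⟩
    by_cases h1 : p.1 = q.1
    · have h2 : p.2 ≠ q.2 := fun h2 => hpq (Prod.ext h1 h2)
      obtain ⟨g, hg⟩ := exists_continuousMap_apply_ne h2
      exact ⟨_, ⟨_, hM 1 g, rfl⟩, by simpa using hg⟩
    · obtain ⟨f, hf⟩ := exists_continuousMap_apply_ne h1
      exact ⟨_, ⟨_, hM f 1, rfl⟩, by simpa using hf⟩
  have htop := ContinuousMap.starSubalgebra_topologicalClosure_eq_top_of_separatesPoints A hsep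
  have hA : ∀ F ∈ A, Λ F = Λ' F := by
    intro F hF
    have hF' : F ∈ Submodule.span ℂ (M : Set C(K × L, ℂ)) := by
      have : F ∈ Subalgebra.toSubmodule (Algebra.adjoin ℂ (M : Set C(K × L, ℂ))) := hF
      rwa [Algebra.adjoin_eq_span, Submonoid.closure_eq] at this
    have hle : Submodule.span ℂ (M : Set C(K × L, ℂ)) ≤
        LinearMap.eqLocus (Λ : C(K × L, ℂ) →ₗ[ℂ] ℂ) (Λ' : C(K × L, ℂ) →ₗ[ℂ] ℂ) := by
      rw [Submodule.span_le]
      rintro _ ⟨f, g, rfl⟩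
      exact h f g
    exact hle hF'
  have hdense : Dense (A : Set C(K × L, ℂ)) := by
    intro F
    rw [← StarSubalgebra.topologicalClosure_coe, htop]
    trivial
  exact ContinuousLinearMap.ext fun F =>
    congrFun (Continuous.ext_on hdense Λ.continuous Λ'.continuous fun F hF => hA F hF) F

/-- Every `f` is a combination of four nonnegative functions. This gives uniqueness of the linear
modulus, which is prescribed only on `f ≥ 0`. -/
theorem linearMap_ext_of_nonneg {K E : Type*} [TopologicalSpace K] [AddCommGroup E] [Module ℂ E]
    {S S' : C(K, ℂ) →ₗ[ℂ] E} (h : ∀ f : C(K, ℂ), 0 ≤ f → S f = S' f) : S = S' := by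
  have real : ∀ g : C(K, ℝ), S ⟨fun x => (g x : ℂ), by fun_prop⟩
      = S' ⟨fun x => (g x : ℂ), by fun_prop⟩ := by
    intro g
    have e : (⟨fun x => (g x : ℂ), by fun_prop⟩ : C(K, ℂ))
        = ⟨fun x => ((max (g x) 0 : ℝ) : ℂ), by fun_prop⟩
          - ⟨fun x => ((max (-g x) 0 : ℝ) : ℂ), by fun_prop⟩ := by
      ext x
      simp only [ContinuousMap.coe_mk, ContinuousMap.sub_apply, ← Complex.ofReal_sub]
      congr 1
      rcases le_total 0 (g x) with h | h <;> simp [h]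
    rw [e, map_sub, map_sub, h, h]
    · intro x
      exact Complex.zero_le_real.2 (le_max_right _ _)
    · intro x
      exact Complex.zero_le_real.2 (le_max_right _ _)
  ext f
  have e : f = ⟨fun x => ((f x).re : ℂ), by fun_prop⟩
      + Complex.I • ⟨fun x => ((f x).im : ℂ), by fun_prop⟩ := by
    ext x
    simp only [ContinuousMap.add_apply, ContinuousMap.smul_apply, ContinuousMap.coe_mk,
      smul_eq_mul]
    rw [mul_comm]
    exact (Complex.re_add_im _).symm
  have h1 := real ⟨fun x => (f x).re, by fun_prop⟩
  have h2 := real ⟨fun x => (f x).im, by fun_prop⟩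
  simp only [ContinuousMap.coe_mk] at h1 h2
  rw [e, map_add, map_add, map_smul, map_smul, h1, h2]

theorem IsLinearModulus.unique {K L : Type*} [TopologicalSpace K] [MeasurableSpace L]
    {μ : Measure L} {T S S' : C(K, ℂ) →ₗ[ℂ] Lp ℂ 1 μ} (h : IsLinearModulus T S)
    (h' : IsLinearModulus T S') : S = S' :=
  linearMap_ext_of_nonneg fun f hf => (h f hf).unique (h' f hf)

section Main

variable {K L : Type*} [TopologicalSpace K] [CompactSpace K] [T2Space K]
  [TopologicalSpace L] [CompactSpace L] [T2Space L] [MeasurableSpace L] [BorelSpace L]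
  [MeasurableSpace (K × L)] [BorelSpace (K × L)] {μ : Measure L}

/-- Products `f ⊗ g` determine the functional on `C(K × L)`, and the functional determines the
regular measure. -/
theorem Represents.measure_unique {T : C(K, ℂ) →ₗ[ℂ] Lp ℂ 1 μ}
    {ρ σ : regularComplexMeasures (K × L)} (hρ : Represents T ρ) (hσ : Represents T σ) :
    ρ = σ := by
  obtain ⟨Λ, hΛ⟩ := regularComplexMeasures.exists_functional ρ
  obtain ⟨Λ', hΛ'⟩ := regularComplexMeasures.exists_functional σ
  have heq : Λ = Λ' := ContinuousMap.functional_ext_of_prod fun f g => by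
    rw [hΛ, hΛ']
    exact (hρ f g).trans (hσ f g).symm
  rw [← sub_eq_zero]
  refine regularComplexMeasures.eq_zero_of_forall_integral _ fun F => ?_
  have hint : ∀ κ : regularComplexMeasures (K × L), (κ : ComplexMeasure (K × L)).Integrable F :=
    fun κ => Integrable.of_bound F.continuous.aestronglyMeasurable ‖F‖
      (ae_of_all _ F.norm_coe_le_norm)
  rw [Submodule.coe_sub, VectorMeasure.integral_sub_vectorMeasure (hint ρ) (hint σ), ← hΛ, ← hΛ',
    heq, sub_self]

theorem Represents.operator_unique [μ.Regular] {T S : C(K, ℂ) →ₗ[ℂ] Lp ℂ 1 μ}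
    {ρ : regularComplexMeasures (K × L)} (hT : Represents T ρ) (hS : Represents S ρ) : T = S := by
  ext1 f
  have hsub : ∀ᵐ y ∂μ, (T f - S f : Lp ℂ 1 μ) y = T f y - S f y := Lp.coeFn_sub _ _
  have hz : (T f - S f : Lp ℂ 1 μ) =ᵐ[μ] 0 := by
    refine ae_eq_zero_of_forall_integral_continuousMap_mul (L1.integrable_coeFn _) fun g => ?_
    have hint : ∀ u : Lp ℂ 1 μ, Integrable (fun y => u y * g y) μ := fun u =>
      (L1.integrable_coeFn u).mul_bdd g.continuous.aestronglyMeasurable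
        (ae_of_all _ g.norm_coe_le_norm)
    have : ∫ y, (T f - S f : Lp ℂ 1 μ) y * g y ∂μ
        = ∫ y, (T f y * g y - S f y * g y) ∂μ := by
      refine integral_congr_ae ?_
      filter_upwards [hsub] with y hy
      rw [hy, sub_mul]
    rw [this, integral_sub (hint _) (hint _), ← hT f g, ← hS f g, sub_self]
  rw [← sub_eq_zero]
  exact Lp.ext (hz.trans (Lp.coeFn_zero ℂ 1 μ).symm)

theorem Represents.add {T S : C(K, ℂ) →ₗ[ℂ] Lp ℂ 1 μ}
    {ρ σ : regularComplexMeasures (K × L)} (hT : Represents T ρ) (hS : Represents S σ) :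
    Represents (T + S) (ρ + σ) := by
  intro f g
  have hint : ∀ κ : regularComplexMeasures (K × L),
      (κ : ComplexMeasure (K × L)).Integrable (fun p => f p.1 * g p.2) := fun κ =>
    Integrable.of_bound (f.comp ContinuousMap.fst *
      g.comp ContinuousMap.snd).continuous.aestronglyMeasurable _ (ae_of_all _
      (f.comp ContinuousMap.fst * g.comp ContinuousMap.snd).norm_coe_le_norm)
  have hint' : ∀ u : Lp ℂ 1 μ, Integrable (fun y => u y * g y) μ := fun u =>
    (L1.integrable_coeFn u).mul_bdd g.continuous.aestronglyMeasurable
      (ae_of_all _ g.norm_coe_le_norm)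
  rw [Submodule.coe_add, VectorMeasure.integral_add_vectorMeasure (hint ρ) (hint σ), hT f g,
    hS f g, ← integral_add (hint' _) (hint' _)]
  refine integral_congr_ae ?_
  filter_upwards [Lp.coeFn_add (T f) (S f)] with y hy
  rw [LinearMap.add_apply, hy, Pi.add_apply, add_mul]

theorem integral_withDensityᵥ_fst_mul_snd {m : Measure (K × L)} {v : K × L → ℂ}
    (hv : Integrable v m) (f : C(K, ℂ)) (g : C(L, ℂ)) :
    (m.withDensityᵥ v).integral (fun p => f p.1 * g p.2) (ContinuousLinearMap.mul ℝ ℂ)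
      = ∫ p, f p.1 * g p.2 * v p ∂m := by
  have hcont : Continuous fun p : K × L => f p.1 * g p.2 := by fun_prop
  refine integral_withDensityᵥ hv (C := ‖f‖ * ‖g‖) (hcont.stronglyMeasurable_of_hasCompactSupport
    (HasCompactSupport.of_compactSpace _)) fun p => ?_
  rw [norm_mul]
  gcongr
  · exact f.norm_coe_le_norm _
  · exact g.norm_coe_le_norm _

theorem Represents.smul {T : C(K, ℂ) →ₗ[ℂ] Lp ℂ 1 μ} {ρ : regularComplexMeasures (K × L)} (c : ℂ)
    (hT : Represents T ρ) : Represents (c • T) (c • ρ) := by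
  intro f g
  obtain ⟨w, -, -, hρ, hwint⟩ := regularComplexMeasures.exists_polar ρ
  have h1 := hT f g
  rw [hρ, integral_withDensityᵥ_fst_mul_snd hwint] at h1
  rw [Submodule.coe_smul, hρ, ← withDensityᵥ_smul,
    integral_withDensityᵥ_fst_mul_snd (hwint.smul c)]
  have h2 : ∫ y, (c • T) f y * g y ∂μ = c * ∫ y, T f y * g y ∂μ := by
    rw [← integral_const_mul]
    refine integral_congr_ae ?_
    filter_upwards [Lp.coeFn_smul c (T f)] with y hy
    rw [LinearMap.smul_apply, hy, Pi.smul_apply, smul_eq_mul, mul_assoc]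
  rw [h2, ← h1, ← integral_const_mul]
  refine integral_congr_ae (ae_of_all _ fun p => ?_)
  simp only [Pi.smul_apply, smul_eq_mul]
  ring

theorem HasDensity.operator_unique {T S : C(K, ℂ) →ₗ[ℂ] Lp ℂ 1 μ} {m : Measure (K × L)}
    {w : K × L → ℂ} (hT : HasDensity T m w) (hS : HasDensity S m w) : T = S :=
  LinearMap.ext fun f => Lp.ext ((hT f).ae_eq measurable_snd_prod (hS f))

theorem HasDensity.add {T S : C(K, ℂ) →ₗ[ℂ] Lp ℂ 1 μ} {m : Measure (K × L)}
    {w v : K × L → ℂ} (hw : Integrable w m) (hv : Integrable v m)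
    (hT : HasDensity T m w) (hS : HasDensity S m v) : HasDensity (T + S) m (w + v) := by
  intro f
  have := (hT f).add measurable_snd_prod (integrable_fst_mul hw f) (integrable_fst_mul hv f) (hS f)
  simp only [← mul_add] at this
  exact this.congr_ae (Lp.coeFn_add (T f) (S f)).symm

theorem HasDensity.smul {T : C(K, ℂ) →ₗ[ℂ] Lp ℂ 1 μ} {m : Measure (K × L)}
    {w : K × L → ℂ} (c : ℂ) (hT : HasDensity T m w) : HasDensity (c • T) m (c • w) := by
  intro f
  have := (hT f).const_mul c
  simp only [mul_left_comm c] at this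
  exact this.congr_ae (Lp.coeFn_smul c (T f)).symm

theorem coe_modulus_eq_withDensityᵥ (ρ : regularComplexMeasures (K × L)) :
    (regularComplexMeasures.modulus ρ : ComplexMeasure (K × L))
      = (ρ : ComplexMeasure (K × L)).variation.withDensityᵥ 1 := by
  ext A hA
  rw [withDensityᵥ_apply (f := 1) (integrable_const _) hA]
  change ((ρ : ComplexMeasure (K × L)).variation.toSignedMeasure.toComplexMeasure 0) A = _
  rw [SignedMeasure.toComplexMeasure_apply, Measure.toSignedMeasure_apply_measurable hA]
  simp only [Pi.one_apply, integral_const, measureReal_restrict_apply_univ]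
  apply Complex.ext <;> simp

/-- A measure whose total variation has an absolutely continuous marginal represents a regular
operator, whose linear modulus is represented by the total variation. -/
theorem exists_represents_of_absolutelyContinuous [IsFiniteMeasure μ]
    {ρ : regularComplexMeasures (K × L)}
    (hac : (ρ : ComplexMeasure (K × L)).variation.map Prod.snd ≪ μ) :
    ∃ T S : C(K, ℂ) →ₗ[ℂ] Lp ℂ 1 μ, Represents T ρ ∧
      Represents S (regularComplexMeasures.modulus ρ) ∧ IsLinearModulus T S ∧
      HasDensity S (ρ : ComplexMeasure (K × L)).variation 1 ∧
      T ∈ regularOperators K μ ∧ S ∈ regularOperators K μ := by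
  obtain ⟨w, hw, hw1, hρ, hwint⟩ := regularComplexMeasures.exists_polar ρ
  have hmod := coe_modulus_eq_withDensityᵥ ρ
  set m := (ρ : ComplexMeasure (K × L)).variation with hm
  have hone : Integrable (1 : K × L → ℂ) m := integrable_const _
  -- Adding `1` makes the real and imaginary parts of the unimodular `w` nonnegative, so these
  -- densities give positive operators.
  have hre : Integrable (fun p => 1 + ((w p).re : ℂ)) m := hone.add hwint.re.ofReal
  have him : Integrable (fun p => 1 + ((w p).im : ℂ)) m := hone.add hwint.im.ofReal
  obtain ⟨T, hT⟩ := exists_hasDensity hac hwint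
  obtain ⟨S, hS⟩ := exists_hasDensity hac hone
  obtain ⟨P, hP⟩ := exists_hasDensity hac hre
  obtain ⟨R, hR⟩ := exists_hasDensity hac him
  have hpos : ∀ {Q : C(K, ℂ) →ₗ[ℂ] Lp ℂ 1 μ}, IsPositiveOperator Q → Q ∈ regularOperators K μ :=
    fun hQ => Submodule.subset_span hQ
  have hSmem := hpos (hS.isPositiveOperator hone fun _ => zero_le_one)
  have hPmem := hpos (hP.isPositiveOperator hre fun p => by
    rw [← Complex.ofReal_one, ← Complex.ofReal_add, Complex.zero_le_real]
    have := (abs_le.1 (Complex.abs_re_le_norm (w p))).1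
    rw [hw1] at this
    linarith)
  have hRmem := hpos (hR.isPositiveOperator him fun p => by
    rw [← Complex.ofReal_one, ← Complex.ofReal_add, Complex.zero_le_real]
    have := (abs_le.1 (Complex.abs_im_le_norm (w p))).1
    rw [hw1] at this
    linarith)
  refine ⟨T, S, hT.represents hwint hρ, hS.represents hone hmod, hT.isLinearModulus hw hw1 hS, hS,
    ?_, hSmem⟩
  -- From `w + (1 + i) = (1 + Re w) + i (1 + Im w)` one reads off `T = P + i R - (1 + i) S`.
  have e1 := hT.add hwint (hone.smul (1 + Complex.I)) (hS.smul (1 + Complex.I))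
  have e2 := hP.add hre (him.smul Complex.I) (hR.smul Complex.I)
  have e3 : w + (1 + Complex.I) • (1 : K × L → ℂ)
      = (fun p => 1 + ((w p).re : ℂ)) + Complex.I • fun p => 1 + ((w p).im : ℂ) := by
    funext p
    simp only [Pi.add_apply, Pi.smul_apply, Pi.one_apply, smul_eq_mul]
    conv_lhs => rw [← Complex.re_add_im (w p)]
    ring
  rw [e3] at e1
  rw [eq_sub_of_add_eq (e1.operator_unique e2)]
  exact sub_mem (add_mem hPmem (Submodule.smul_mem _ _ hRmem)) (Submodule.smul_mem _ _ hSmem)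

/-- An order-bounded operator is represented by a measure whose total variation has an absolutely
continuous marginal. -/
theorem IsOrderBounded.exists_represents [IsFiniteMeasure μ] [μ.Regular]
    {T : C(K, ℂ) →ₗ[ℂ] Lp ℂ 1 μ} (hT : IsOrderBounded T) :
    ∃ ρ : regularComplexMeasures (K × L), Represents T ρ ∧
      (ρ : ComplexMeasure (K × L)).variation.map Prod.snd ≪ μ := by
  obtain ⟨h, hh, h0, hle⟩ := hT.exists_integrable_bound
  obtain ⟨Λ, hΛ, hΛ'⟩ := exists_functional_of_dominated T hh h0 hle
  obtain ⟨ρ, hρ⟩ := exists_regularComplexMeasure_integral_eq Λ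
  have hreg : (μ.withDensity fun y => ENNReal.ofReal (h y)).Regular := regular_withDensity
    (by rw [← ofReal_integral_eq_lintegral_ofReal hh (ae_of_all _ h0)]; exact ENNReal.ofReal_ne_top)
  refine ⟨ρ, fun f g => ?_, ?_⟩
  · rw [← hΛ', ← hρ]
    rfl
  · exact (Measure.absolutelyContinuous_of_le (map_snd_variation_le fun F => by
      rw [hρ]; exact hΛ F)).trans (withDensity_absolutelyContinuous _ _)

end Main

/-! ### Regular operators, the regular norm and the range -/

section Regular

variable {K L : Type*} [TopologicalSpace K] [MeasurableSpace L] {μ : Measure L}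

/-- `|z|` is the value of `Re (e^{it} z)` at `t = -arg z`. Rational angles suffice by continuity,
and a countable family is what an almost everywhere statement can handle. -/
theorem Complex.norm_le_of_forall_rat_rotation {z : ℂ} {r : ℝ}
    (h : ∀ q : ℚ, (Complex.exp (q * Complex.I) * z).re ≤ r) : ‖z‖ ≤ r := by
  have hall : ∀ t : ℝ, (Complex.exp (t * Complex.I) * z).re ≤ r := by
    have hclosed : IsClosed {t : ℝ | (Complex.exp (t * Complex.I) * z).re ≤ r} :=
      isClosed_le (by fun_prop) continuous_const
    have hsub : Set.range ((↑) : ℚ → ℝ) ⊆ {t : ℝ | (Complex.exp (t * Complex.I) * z).re ≤ r} := by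
      rintro _ ⟨q, rfl⟩
      have e : ((q : ℝ) : ℂ) = (q : ℂ) := by push_cast; rfl
      rw [Set.mem_ofPred_eq, e]
      exact h q
    intro t
    exact hclosed.closure_subset_iff.2 hsub (Rat.denseRange_cast t)
  have h1 := hall (-z.arg)
  have h2 : Complex.exp ((-z.arg : ℝ) * Complex.I) * z = ‖z‖ := by
    conv_lhs => rw [← Complex.norm_mul_exp_arg_mul_I z]
    rw [mul_left_comm, ← Complex.exp_add]
    simp
  rw [h2] at h1
  simpa using h1

/-- Positivity applied to `f - Re u` and `f - Im u` shows that `T (Re u)` and `T (Im u)` are real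
and at most `T f`; hence `Re (T u) = T (Re u)`. -/
theorem IsPositiveOperator.re_le {T : C(K, ℂ) →ₗ[ℂ] Lp ℂ 1 μ} (hT : IsPositiveOperator T)
    {u f : C(K, ℂ)} (h : AbsLE u f) : ∀ᵐ y ∂μ, (T u y).re ≤ (T f y).re := by
  let r : C(K, ℂ) := ⟨fun x => ((u x).re : ℂ), by fun_prop⟩
  let i : C(K, ℂ) := ⟨fun x => ((u x).im : ℂ), by fun_prop⟩
  have hbd : ∀ x, ‖u x‖ ≤ (f x).re ∧ (f x).im = 0 := fun x => Complex.ofReal_le_iff.1 (h x)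
  have real_of_real : ∀ v : C(K, ℂ), (∀ x, ‖v x‖ ≤ (f x).re) → (∀ x, (v x).im = 0) →
      ∀ᵐ y ∂μ, (T v y).re ≤ (T f y).re ∧ (T v y).im = 0 := by
    intro v hv hv'
    have h1 := Lp_nonneg_iff.1 (hT (f - v) fun x => by
      change 0 ≤ f x - v x
      rw [Complex.le_def]
      exact ⟨by simpa using (Complex.re_le_norm _).trans (hv x), by simp [hv' x, (hbd x).2]⟩)
    have h2 := Lp_nonneg_iff.1 (hT f fun x => by
      change 0 ≤ f x
      rw [Complex.le_def]
      exact ⟨(norm_nonneg _).trans (hv x), by simp [(hbd x).2]⟩)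
    rw [map_sub] at h1
    filter_upwards [h1, h2, Lp.coeFn_sub (T f) (T v)] with y h1 h2 h3
    rw [h3, Pi.sub_apply, Complex.sub_re, Complex.sub_im] at h1
    exact ⟨by linarith [h1.1], by linarith [h1.2, h2.2]⟩
  have hr := real_of_real r (fun x => by
    simpa [r] using (Complex.abs_re_le_norm (u x)).trans (hbd x).1) (fun x => by simp [r])
  have hi := real_of_real i (fun x => by
    simpa [i] using (Complex.abs_im_le_norm (u x)).trans (hbd x).1) (fun x => by simp [i])
  have e : u = r + Complex.I • i := by
    ext x
    simp only [r, i, ContinuousMap.add_apply, ContinuousMap.smul_apply, ContinuousMap.coe_mk,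
      smul_eq_mul]
    rw [mul_comm]
    exact (Complex.re_add_im _).symm
  have hTu : T u = T r + Complex.I • T i := by rw [← map_smul, ← map_add, ← e]
  rw [hTu]
  filter_upwards [hr, hi, Lp.coeFn_add (T r) (Complex.I • T i),
    Lp.coeFn_smul Complex.I (T i)] with y h1 h2 h3 h4
  rw [h3, Pi.add_apply, h4, Pi.smul_apply, smul_eq_mul, Complex.add_re, Complex.I_mul_re, h2.2]
  simpa using h1.1

/-- The condition `|u| ≤ f` is invariant under rotation of `u`, so the bound on real parts upgrades
to `|T u| ≤ T f`. -/
theorem IsPositiveOperator.isOrderBounded {T : C(K, ℂ) →ₗ[ℂ] Lp ℂ 1 μ}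
    (hT : IsPositiveOperator T) : IsOrderBounded T := by
  intro f hf
  refine ⟨T f, hT f hf, fun u hu => L1abs_le_iff.2 ?_⟩
  have h1 : ∀ᵐ y ∂μ, ∀ q : ℚ, (Complex.exp (q * Complex.I) * T u y).re ≤ (T f y).re := by
    rw [ae_all_iff]
    intro q
    have h2 := hT.re_le (u := Complex.exp (q * Complex.I) • u) (f := f) fun x => by
      have h3 : ‖Complex.exp (q * Complex.I)‖ = 1 := by
        simpa using Complex.norm_exp_ofReal_mul_I (q : ℝ)
      rw [ContinuousMap.smul_apply, norm_smul, h3, one_mul]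
      exact hu x
    rw [map_smul] at h2
    filter_upwards [h2, Lp.coeFn_smul (Complex.exp (q * Complex.I)) (T u)] with y h3 h4
    rw [h4] at h3
    exact h3
  filter_upwards [h1, Lp_nonneg_iff.1 (hT f hf)] with y h1 h2
  exact ⟨Complex.norm_le_of_forall_rat_rotation h1, h2.2⟩

theorem IsOrderBounded.of_mem_regularOperators {T : C(K, ℂ) →ₗ[ℂ] Lp ℂ 1 μ}
    (hT : T ∈ regularOperators K μ) : IsOrderBounded T := by
  induction hT using Submodule.span_induction with
  | mem T hT => exact IsPositiveOperator.isOrderBounded hT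
  | zero =>
    intro f _
    refine ⟨0, le_rfl, fun u _ => L1abs_le_iff.2 ?_⟩
    rw [LinearMap.zero_apply]
    filter_upwards [Lp.coeFn_zero ℂ 1 μ] with y hy
    rw [hy]
    simp
  | add T S _ _ hT hS =>
    intro f hf
    obtain ⟨h, h0, hh⟩ := hT f hf
    obtain ⟨k, k0, hk⟩ := hS f hf
    refine ⟨h + k, add_nonneg h0 k0, fun u hu => L1abs_le_iff.2 ?_⟩
    filter_upwards [L1abs_le_iff.1 (hh u hu), L1abs_le_iff.1 (hk u hu), Lp.coeFn_add h k,
      Lp.coeFn_add (T u) (S u)] with y h1 h2 h3 h4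
    rw [LinearMap.add_apply, h3, h4, Pi.add_apply, Pi.add_apply, Complex.add_re, Complex.add_im,
      h1.2, h2.2]
    exact ⟨(norm_add_le _ _).trans (add_le_add h1.1 h2.1), by simp⟩
  | smul c T _ hT =>
    intro f hf
    obtain ⟨h, h0, hh⟩ := hT f hf
    refine ⟨((‖c‖ : ℝ) : ℂ) • h, Lp_nonneg_iff.2 ?_, fun u hu => L1abs_le_iff.2 ?_⟩
    · filter_upwards [Lp_nonneg_iff.1 h0, Lp.coeFn_smul ((‖c‖ : ℝ) : ℂ) h] with y h1 h2
      rw [h2, Pi.smul_apply, smul_eq_mul, Complex.re_ofReal_mul, Complex.im_ofReal_mul, h1.2]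
      exact ⟨mul_nonneg (norm_nonneg _) h1.1, mul_zero _⟩
    · filter_upwards [L1abs_le_iff.1 (hh u hu), Lp.coeFn_smul ((‖c‖ : ℝ) : ℂ) h,
        Lp.coeFn_smul c (T u)] with y h1 h2 h3
      rw [LinearMap.smul_apply, h2, h3, Pi.smul_apply, Pi.smul_apply, smul_eq_mul,
        smul_eq_mul, Complex.re_ofReal_mul, Complex.im_ofReal_mul, h1.2, norm_mul]
      exact ⟨mul_le_mul_of_nonneg_left h1.1 (norm_nonneg _), mul_zero _⟩

end Regular

section Main

variable {K L : Type*} [TopologicalSpace K] [CompactSpace K] [T2Space K]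
  [TopologicalSpace L] [CompactSpace L] [T2Space L] [MeasurableSpace L] [BorelSpace L]
  [MeasurableSpace (K × L)] [BorelSpace (K × L)] {μ : Measure L}

theorem IsLinearModulus.eq_linearModulus {T S : C(K, ℂ) →ₗ[ℂ] Lp ℂ 1 μ}
    (h : IsLinearModulus T S) : linearModulus T = S := by
  have hex : ∃ S, IsLinearModulus T S := ⟨S, h⟩
  rw [linearModulus, dif_pos hex]
  exact hex.choose_spec.unique h

theorem Represents.eq_reprMeasure {T : C(K, ℂ) →ₗ[ℂ] Lp ℂ 1 μ}
    {ρ : regularComplexMeasures (K × L)} (h : Represents T ρ) : reprMeasure T = ρ := by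
  have hex : ∃ ρ : regularComplexMeasures (K × L), Represents T ρ := ⟨ρ, h⟩
  rw [reprMeasure, dif_pos hex]
  exact hex.choose_spec.measure_unique h

/-- The operator rebuilt from the density of `ρ` is represented by the same `ρ` as `T`, so it is
`T`, and its modulus is that of `T`. -/
theorem IsOrderBounded.exists_measure_modulus [IsFiniteMeasure μ] [μ.Regular]
    {T : C(K, ℂ) →ₗ[ℂ] Lp ℂ 1 μ} (hT : IsOrderBounded T) :
    ∃ ρ : regularComplexMeasures (K × L), Represents T ρ ∧
      (ρ : ComplexMeasure (K × L)).variation.map Prod.snd ≪ μ ∧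
      IsLinearModulus T (linearModulus T) ∧
      Represents (linearModulus T) (regularComplexMeasures.modulus ρ) ∧
      HasDensity (linearModulus T) (ρ : ComplexMeasure (K × L)).variation 1 ∧
      linearModulus T ∈ regularOperators K μ := by
  obtain ⟨ρ, hρ, hac⟩ := hT.exists_represents (K := K)
  obtain ⟨T', S, hT', hS, hmod, hd, -, hmem⟩ := exists_represents_of_absolutelyContinuous hac
  obtain rfl := hρ.operator_unique hT'
  obtain rfl := hmod.eq_linearModulus
  exact ⟨ρ, hρ, hac, hmod, hS, hd, hmem⟩

/-- The operator with density `1` with respect to `m` is bounded, with norm the mass of `m`. -/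
theorem HasDensity.exists_continuousLinearMap {S : C(K, ℂ) →ₗ[ℂ] Lp ℂ 1 μ}
    {m : Measure (K × L)} [IsFiniteMeasure m] (hS : HasDensity S m 1) :
    ∃ A : C(K, ℂ) →L[ℂ] Lp ℂ 1 μ, (A : C(K, ℂ) →ₗ[ℂ] Lp ℂ 1 μ) = S ∧
      m.real Set.univ = ‖A‖ := by
  have hone : Integrable (1 : K × L → ℂ) m := integrable_const _
  have htot : ∀ f : C(K, ℂ), ∫ y, S f y ∂μ = ∫ p, f p.1 ∂m := fun f => by
    simpa using (hS f).setIntegral measurable_snd_prod MeasurableSet.univ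
  have hbound : ∀ f, ‖S f‖ ≤ m.real Set.univ * ‖f‖ := by
    intro f
    -- Integrating `|S f| ≤ S g` for the constant `g = ‖f‖` gives the upper bound on the norm; the
    -- function `1` attains it.
    let g : C(K, ℂ) := ContinuousMap.const K ((‖f‖ : ℝ) : ℂ)
    have h1 : ∀ᵐ y ∂μ, ‖S f y‖ ≤ (S g y).re := hS.ae_norm_le hS hone fun p => by
      simpa [g] using f.norm_coe_le_norm p.1
    have hint := L1.integrable_coeFn (S g)
    rw [L1.norm_eq_integral_norm]
    calc ∫ y, ‖S f y‖ ∂μ ≤ ∫ y, (S g y).re ∂μ :=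
          integral_mono_ae (L1.integrable_coeFn (S f)).norm hint.re h1
      _ = (∫ y, S g y ∂μ).re := integral_re hint
      _ = m.real Set.univ * ‖f‖ := by
          rw [htot]
          simp [g]
  refine ⟨S.mkContinuous _ hbound, by ext1; rfl, le_antisymm ?_
    (LinearMap.mkContinuous_norm_le _ measureReal_nonneg _)⟩
  set A := S.mkContinuous _ hbound
  have h1 : m.real Set.univ = ‖∫ y, S 1 y ∂μ‖ := by
    rw [htot]
    simp [abs_of_nonneg]
  calc m.real Set.univ = ‖∫ y, S 1 y ∂μ‖ := h1
    _ ≤ ∫ y, ‖S 1 y‖ ∂μ := norm_integral_le_integral_norm _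
    _ = ‖A 1‖ := (L1.norm_eq_integral_norm _).symm
    _ ≤ ‖A‖ * ‖(1 : C(K, ℂ))‖ := A.le_opNorm _
    _ ≤ ‖A‖ * 1 := by
        gcongr
        exact (ContinuousMap.norm_le _ zero_le_one).2 fun x => by simp
    _ = ‖A‖ := mul_one _

/-- The measures whose total variation has an absolutely continuous marginal form a closed
ideal. -/
theorem isClosedLatticeIdeal_absolutelyContinuous (μ : Measure L) :
    IsClosedLatticeIdeal {ρ : regularComplexMeasures (K × L) |
      (ρ : ComplexMeasure (K × L)).variation.map Prod.snd ≪ μ} := by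
  have hsnd : Measurable (Prod.snd : K × L → L) := measurable_snd_prod
  have solid : ∀ {m m' : Measure (K × L)}, m' ≤ m → m.map Prod.snd ≪ μ → m'.map Prod.snd ≪ μ :=
    fun hle hm => (Measure.absolutelyContinuous_of_le (Measure.map_mono hle hsnd)).trans hm
  refine ⟨?_, fun ρ hρ σ hσ => ?_, fun c ρ hρ => ?_, fun ρ hρ σ hle => solid hle hρ, ?_⟩
  · simp only [Set.mem_ofPred_eq, Submodule.coe_zero, VectorMeasure.variation_zero,
      Measure.map_zero]
    exact Measure.AbsolutelyContinuous.zero μ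
  · refine solid VectorMeasure.variation_add_le ?_
    rw [Measure.map_add _ _ hsnd]
    exact Measure.AbsolutelyContinuous.add_left hρ hσ
  · simp only [Set.mem_ofPred_eq, Submodule.coe_smul, VectorMeasure.variation_smul]
    rw [Measure.map_smul]
    exact Measure.AbsolutelyContinuous.smul_left hρ _
  · rw [← closure_subset_iff_isClosed]
    intro ρ hρ
    refine Measure.AbsolutelyContinuous.mk fun N hN hN0 => ?_
    rw [Measure.map_apply hsnd hN]
    rw [← measureReal_eq_zero_iff]
    refine le_antisymm (le_of_forall_pos_le_add fun ε hε => ?_) measureReal_nonneg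
    obtain ⟨σ, hσ, hlt⟩ := Metric.mem_closure_iff.1 hρ ε hε
    rw [dist_eq_norm, regularComplexMeasures.norm_def] at hlt
    -- Since `|ρ| ≤ |ρ - σ| + |σ|` and `|σ|` vanishes over the null set `N`, the mass of `|ρ|` over
    -- `N` is at most `‖ρ - σ‖`.
    have h1 : (ρ : ComplexMeasure (K × L)).variation ≤
        ((ρ - σ : regularComplexMeasures (K × L)) : ComplexMeasure (K × L)).variation
          + (σ : ComplexMeasure (K × L)).variation := by
      have : (ρ : ComplexMeasure (K × L)) =
          ((ρ - σ : regularComplexMeasures (K × L)) : ComplexMeasure (K × L)) + σ := by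
        rw [Submodule.coe_sub, sub_add_cancel]
      conv_lhs => rw [this]
      exact VectorMeasure.variation_add_le
    have h2 : (σ : ComplexMeasure (K × L)).variation (Prod.snd ⁻¹' N) = 0 := by
      have := hσ hN0
      rwa [Measure.map_apply hsnd hN] at this
    have h3 := h1 (Prod.snd ⁻¹' N)
    rw [Measure.add_apply, h2, add_zero] at h3
    rw [zero_add]
    exact (ENNReal.toReal_mono (measure_ne_top _ _)
      (h3.trans (measure_mono (Set.subset_univ _)))).trans hlt.le

end Main

theorem theorem4p7 {K L : Type*}
    [TopologicalSpace K] [CompactSpace K] [T2Space K]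
    [TopologicalSpace L] [CompactSpace L] [T2Space L] [MeasurableSpace L] [BorelSpace L]
    [MeasurableSpace (K × L)] [BorelSpace (K × L)]
    (μ : Measure L) [IsFiniteMeasure μ] [μ.Regular] :
    -- for order-bounded `T`, the operator `|T|` and the measures `μ_T`, `μ_{|T|}` exist and are
    -- unique, and `|μ_T| = μ_{|T|}`
    (∀ T : C(K, ℂ) →ₗ[ℂ] Lp ℂ 1 μ, IsOrderBounded T →
      (∀ S, IsLinearModulus T S ↔ S = linearModulus T) ∧
      (∀ ρ : regularComplexMeasures (K × L), Represents T ρ ↔ ρ = reprMeasure T) ∧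
      (∀ ρ : regularComplexMeasures (K × L),
        Represents (linearModulus T) ρ ↔ ρ = reprMeasure (linearModulus T)) ∧
      regularComplexMeasures.modulus (reprMeasure T) = reprMeasure (linearModulus T)) ∧
    -- `T ↦ μ_T` is linear on the regular operators ...
    ∃ Φ : regularOperators K μ →ₗ[ℂ] regularComplexMeasures (K × L),
      (∀ T : regularOperators K μ, Represents (T : C(K, ℂ) →ₗ[ℂ] Lp ℂ 1 μ) (Φ T) ∧
        Φ T = reprMeasure (T : C(K, ℂ) →ₗ[ℂ] Lp ℂ 1 μ)) ∧
      -- ... a lattice homomorphism: `Φ |T| = |Φ T|` ...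
      (∀ T : regularOperators K μ,
        IsLinearModulus (T : C(K, ℂ) →ₗ[ℂ] Lp ℂ 1 μ) (linearModulus T) ∧
        ∃ hT : linearModulus (T : C(K, ℂ) →ₗ[ℂ] Lp ℂ 1 μ) ∈ regularOperators K μ,
          Φ ⟨linearModulus T, hT⟩ = regularComplexMeasures.modulus (Φ T)) ∧
      -- ... isometric for the regular norm, the operator norm of `|T|` ...
      (∀ T : regularOperators K μ, ∃ A : C(K, ℂ) →L[ℂ] Lp ℂ 1 μ,
        (A : C(K, ℂ) →ₗ[ℂ] Lp ℂ 1 μ) = linearModulus (T : C(K, ℂ) →ₗ[ℂ] Lp ℂ 1 μ) ∧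
        ‖Φ T‖ = ‖A‖) ∧
      -- ... whose range is the stated set, which is a closed ideal
      Set.range Φ = {ρ : regularComplexMeasures (K × L) |
        (ρ : ComplexMeasure (K × L)).variation.map Prod.snd ≪ μ} ∧
      IsClosedLatticeIdeal {ρ : regularComplexMeasures (K × L) |
        (ρ : ComplexMeasure (K × L)).variation.map Prod.snd ≪ μ} := by
  have reg : ∀ T : regularOperators K μ, IsOrderBounded (T : C(K, ℂ) →ₗ[ℂ] Lp ℂ 1 μ) := fun T =>
    IsOrderBounded.of_mem_regularOperators T.2
  have repr : ∀ T : regularOperators K μ,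
      Represents (T : C(K, ℂ) →ₗ[ℂ] Lp ℂ 1 μ)
        (reprMeasure (T : C(K, ℂ) →ₗ[ℂ] Lp ℂ 1 μ) : regularComplexMeasures (K × L)) := fun T => by
    obtain ⟨ρ, hρ, -⟩ := (reg T).exists_measure_modulus (K := K)
    rwa [hρ.eq_reprMeasure]
  -- Linearity is uniqueness again: sums and multiples of representing measures represent the
  -- corresponding operators.
  refine ⟨fun T hT => ?_, { toFun := fun T => reprMeasure (T : C(K, ℂ) →ₗ[ℂ] Lp ℂ 1 μ)
                            map_add' := fun T S => ((repr T).add (repr S)).eq_reprMeasure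
                            map_smul' := fun c T => ((repr T).smul c).eq_reprMeasure },
    fun T => ⟨repr T, rfl⟩, fun T => ?_, fun T => ?_, ?_,
    isClosedLatticeIdeal_absolutelyContinuous μ⟩
  · obtain ⟨ρ, hρ, -, hmod, hS, -, -⟩ := hT.exists_measure_modulus (K := K)
    refine ⟨fun S => ⟨fun h => h.unique hmod, fun h => h ▸ hmod⟩,
      fun σ => ⟨fun h => h.eq_reprMeasure.symm, fun h => ?_⟩,
      fun σ => ⟨fun h => h.eq_reprMeasure.symm, fun h => ?_⟩, ?_⟩
    · rwa [h, hρ.eq_reprMeasure]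
    · rwa [h, hS.eq_reprMeasure]
    · rw [hρ.eq_reprMeasure, hS.eq_reprMeasure]
  · obtain ⟨ρ, hρ, -, hmod, hS, -, hmem⟩ := (reg T).exists_measure_modulus (K := K)
    refine ⟨hmod, hmem, ?_⟩
    change reprMeasure (linearModulus (T : C(K, ℂ) →ₗ[ℂ] Lp ℂ 1 μ))
      = regularComplexMeasures.modulus (reprMeasure (T : C(K, ℂ) →ₗ[ℂ] Lp ℂ 1 μ))
    rw [hρ.eq_reprMeasure, hS.eq_reprMeasure]
  · obtain ⟨ρ, hρ, -, -, -, hd, -⟩ := (reg T).exists_measure_modulus (K := K)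
    obtain ⟨A, hA, hnorm⟩ := hd.exists_continuousLinearMap
    refine ⟨A, hA, ?_⟩
    change ‖reprMeasure (T : C(K, ℂ) →ₗ[ℂ] Lp ℂ 1 μ)‖ = ‖A‖
    rw [hρ.eq_reprMeasure, ← hnorm, regularComplexMeasures.norm_def]
  · refine Set.Subset.antisymm ?_ fun ρ hρ => ?_
    · rintro _ ⟨T, rfl⟩
      obtain ⟨ρ, hρ, hac, -⟩ := (reg T).exists_measure_modulus (K := K)
      change (reprMeasure (T : C(K, ℂ) →ₗ[ℂ] Lp ℂ 1 μ) : ComplexMeasure (K × L)).variation.map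
        Prod.snd ≪ μ
      rwa [hρ.eq_reprMeasure]
    · obtain ⟨T, -, hT, -, -, -, hmem, -⟩ := exists_represents_of_absolutelyContinuous hρ
      exact ⟨⟨T, hmem⟩, hT.eq_reprMeasure⟩
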